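/- Let $d\ge 1$ and $n$ be integers with $d<n/2$, let $0<p<1$, and let $X_1,\ldots,X_n$ be independent $\{0,1\}$-valued random variables with $\mathbb{P}(X_i=1)=p$ and $\mathbb{P}(X_i=0)=1-p$; extend the indices periodically by $X_{n+k}=X_k$. For $1\le i\le d$ put $$V_i=\sum_{m=1}^n\big(X_mX_{m+1}\cdots X_{m+i-1}-p^i\big),\qquad W_i=\frac{V_i}{\sqrt{np^i(1-p)}},$$ and let $W=(W_1,\ldots,W_d)$. Let $\Sigma=[\sigma_{ij}]_{i,j=1}^d$ with $$\sigma_{ij}=p^{|i-j|/2}\sum_{k=0}^{\min(i,j)-1}\big(|i-j|+1+2k\big)p^k .$$ For a function $h$ on $\mathbb{R}^d$ let $M_k(h)=\sup_{x\in\mathbb{R}^d}\|D^kh(x)\|_{op}\in[0,\infty]$, where the $k$-th derivative $D^kh(x)$ is regarded as a $k$-linear form on Euclidean $\mathbb{R}^d$ and $\|A\|_{op}=\sup\{|A(u_1,\ldots,u_k)|:|u_1|=\cdots=|u_k|=1\}$. Let $Z$ be a standard $d$-dimensional Gaussian random vector. Then $\mathbb{E}[W_iW_j]=\sigma_{ij}$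 for all $1\le i,j\le d$; in particular $\Sigma$ is positive semidefinite, and $\Sigma^{1/2}$ denotes its positive semidefinite square root. Moreover, for every $h\in C^3(\mathbb{R}^d)$, the expectation $\mathbb{E}h(W)$ exists, and $$\big|\mathbb{E}h(W)-\mathbb{E}h(\Sigma^{1/2}Z)\big|\le\frac{15\sqrt6\,d^3M_2(h)}{p^d(1-p)\sqrt n}+\frac{40\,d^{7/2}M_3(h)}{3\,p^{3d/2}(1-p)^{3/2}\sqrt n},$$ where $\mathbb{E}h(\Sigma^{1/2}Z)$ exists whenever $M_2(h)$ and $M_3(h)$ are finite (if one of them is infinite, the right-hand side is $\infty$ and the bound is void). -/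

import Mathlib

open MeasureTheory ProbabilityTheory
open scoped ENNReal MatrixOrder

noncomputable section

namespace RunsOnLine

/-- The centred number of `i`-runs `V_i = ∑ₘ (X_m X_{m+1} ⋯ X_{m+i-1} - p ^ i)` among the
`n` trials `X`, with the torus convention (indices are read modulo `n`; the trials are labelled
`0, …, n - 1`). -/
def centeredRuns {Ω : Type*} {n : ℕ} (X : Fin n → Ω → ℝ) (p : ℝ) (i : ℕ) (ω : Ω) : ℝ :=
  ∑ m : Fin n,
    ((∏ k ∈ Finset.range i, X ⟨((m : ℕ) + k) % n, Nat.mod_lt _ m.pos⟩ ω) - p ^ i)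

/-- The random vector `W = (W_1, …, W_d)`, `W_i = V_i / √(n p ^ i (1 - p))`.  The coordinate with
index `i : Fin d` is the one that the mathematics calls `W_{i+1}`. -/
def runsVector {Ω : Type*} {n : ℕ} (X : Fin n → Ω → ℝ) (p : ℝ) (d : ℕ) (ω : Ω) :
    EuclideanSpace ℝ (Fin d) :=
  WithLp.toLp 2 fun i : Fin d =>
    centeredRuns X p ((i : ℕ) + 1) ω / Real.sqrt (n * p ^ ((i : ℕ) + 1) * (1 - p))

/-- The `d × d` matrix with entries
`σ_{ij} = p ^ (|i - j| / 2) ∑_{k=0}^{min(i,j)-1} (|i - j| + 1 + 2 k) p ^ k` for `1 ≤ i, j ≤ d`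
(indices `i j : Fin d` stand for `i + 1` and `j + 1`). -/
def runsCov (p : ℝ) (d : ℕ) : Matrix (Fin d) (Fin d) ℝ :=
  Matrix.of fun i j =>
    p ^ (|(i : ℝ) - (j : ℝ)| / 2) *
      ∑ k ∈ Finset.range (min ((i : ℕ) + 1) ((j : ℕ) + 1)),
        (|(i : ℝ) - (j : ℝ)| + 1 + 2 * (k : ℝ)) * p ^ k

/-- `M_k(f) = sup_x ‖D^k f(x)‖_op`, the operator norm being that of a `k`-linear form on Euclidean
space; the value is `∞` when the `k`-th derivative is unbounded. -/
def supNormDeriv {d : ℕ} (k : ℕ) (f : EuclideanSpace ℝ (Fin d) → ℝ) : ℝ≥0∞ :=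
  ⨆ x, ‖iteratedFDeriv ℝ k f x‖ₑ

/-- The linear map `z ↦ S ^ (1/2) z`, where `S ^ (1/2)` is the positive semidefinite square root of
the positive semidefinite matrix `S`. -/
def applySqrt {d : ℕ} (S : Matrix (Fin d) (Fin d) ℝ) (z : EuclideanSpace ℝ (Fin d)) :
    EuclideanSpace ℝ (Fin d) :=
  Matrix.toEuclideanCLM (𝕜 := ℝ) (CFC.sqrt S) z

end RunsOnLine

end

noncomputable section

set_option linter.unusedSectionVars false
set_option maxSynthPendingDepth 3

namespace RunsOnLine

/-! ### Taylor bounds from Lipschitz derivatives -/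

section Taylor

variable {E : Type*} [NormedAddCommGroup E] [NormedSpace ℝ E]

/-! `W` is a sum of `n` bounded centred vectors, one per starting point `m`, and the vector at `m`
depends only on the `d` trials of its window. It is therefore independent of the sum over all but at
most `K = 2d` neighbours. For such sums, removing the neighbours by Taylor expansion gives an
approximate Stein identity (`LocallyDependent.abs_integral_sub_le`): `E Df(aW+y)[W]` equals `a E
D²f(aW+y)[W',W']`, with `W'` an independent copy of `W`, up to `A a²`, where `A = 5 n K² b³ M₃` and
`b` bounds the summands.

The identity is integrated along `F(t) = E f(√t W + √(1-t) G)`, with `G` Gaussian of the same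
covariance as `W` (`abs_integral_sub_integral_gaussian_le`). Instead of differentiating in `t`,
`[0,1]` is cut into `N` steps, and each step trades a Gaussian increment for extra weight on `W`.
The second-order terms match, each step costs its length times `A/2` plus a remainder, and the
remainders sum to `O(N^(-1/2))`. The limit `A/2` involves `M₃` only: finiteness of `M₂` serves for
integrability and to control the remainders, so the `M₂` term of the theorem is slack.

The covariance is a count: products of `0/1` variables over two windows multiply to the product over
the union, so each covariance depends only on the overlap (`sum_range_pow_overlap`). As a matrix of
second moments it is positive semidefinite. -/

lemma norm_sub_le_mul_norm_of_norm_fderiv_le {F : Type*} [NormedAddCommGroup F] [NormedSpace ℝ F]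
    {f : E → F} (hf : Differentiable ℝ f) {M : ℝ} (hM : ∀ x, ‖fderiv ℝ f x‖ ≤ M) (x y : E) :
    ‖f y - f x‖ ≤ M * ‖y - x‖ :=
  convex_univ.norm_image_sub_le_of_norm_fderiv_le (fun z _ => hf z) (fun z _ => hM z)
    (Set.mem_univ x) (Set.mem_univ y)

/-- First-order Taylor bound for a map whose derivative is Lipschitz. -/
lemma norm_taylor_one_le {F : Type*} [NormedAddCommGroup F] [NormedSpace ℝ F]
    {f : E → F} (hf : Differentiable ℝ f) {M : ℝ} (hM0 : 0 ≤ M)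
    (hM : ∀ x y, ‖fderiv ℝ f x - fderiv ℝ f y‖ ≤ M * ‖x - y‖) (x u : E) :
    ‖f (x + u) - f x - fderiv ℝ f x u‖ ≤ M * ‖u‖ ^ 2 := by
  -- Mean value inequality for `f` minus its linear part at `x`. The sharp constant `M / 2` is given
  -- up.
  have key := (convex_segment x (x + u)).norm_image_sub_le_of_norm_hasFDerivWithin_le'
    (f := f) (f' := fderiv ℝ f) (φ := fderiv ℝ f x) (C := M * ‖u‖)
    (fun z _ => (hf z).hasFDerivAt.hasFDerivWithinAt)
    (fun z hz => by
      refine (hM z x).trans ?_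
      gcongr
      rw [segment_eq_image'] at hz
      obtain ⟨θ, ⟨h0, h1⟩, rfl⟩ := hz
      simp only [add_sub_cancel_left, norm_smul, Real.norm_eq_abs, abs_of_nonneg h0]
      exact mul_le_of_le_one_left (norm_nonneg _) h1)
    (left_mem_segment ℝ _ _) (right_mem_segment ℝ _ _)
  simpa [pow_two, mul_assoc] using key

/-- Second-order Taylor bound for a function whose second derivative is Lipschitz. -/
lemma abs_taylor_two_le {f : E → ℝ} (hf : ContDiff ℝ 2 f) {M : ℝ} (hM0 : 0 ≤ M)
    (hM : ∀ x y, ‖fderiv ℝ (fderiv ℝ f) x - fderiv ℝ (fderiv ℝ f) y‖ ≤ M * ‖x - y‖) (x u : E) :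
    |f (x + u) - f x - fderiv ℝ f x u - 1 / 2 * fderiv ℝ (fderiv ℝ f) x u u| ≤ M * ‖u‖ ^ 3 := by
  have hd1 : Differentiable ℝ (fderiv ℝ f) :=
    (hf.fderiv_right (m := 1) (by norm_num)).differentiable (by norm_num)
  have hd : Differentiable ℝ f := hf.differentiable (by norm_num)
  have hsymm : ∀ v w, fderiv ℝ (fderiv ℝ f) x v w = fderiv ℝ (fderiv ℝ f) x w v := fun v w =>
    (hf.contDiffAt.isSymmSndFDerivAt (by simp)) v w
  set B := fderiv ℝ (fderiv ℝ f) x with hB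
  -- By symmetry of `B`, the derivative of `φ` is the first-order Taylor remainder of `fderiv ℝ f`,
  -- which `norm_taylor_one_le` controls.
  let φ : E → ℝ := fun v => f (x + v) - fderiv ℝ f x v - 1 / 2 * B v v
  have hφ : ∀ v, HasFDerivAt φ (fderiv ℝ f (x + v) - fderiv ℝ f x - B v) v := by
    intro v
    have h1 : HasFDerivAt (fun v => f (x + v)) (fderiv ℝ f (x + v)) v :=
      (hasFDerivAt_comp_add_left x).2 (hd (x + v)).hasFDerivAt
    have h2 : HasFDerivAt (fun v => fderiv ℝ f x v) (fderiv ℝ f x) v :=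
      (fderiv ℝ f x).hasFDerivAt
    have h3 := (B.hasFDerivAt (x := v)).clm_apply (hasFDerivAt_id v)
    have h4 := (h1.sub h2).sub (h3.const_mul (1 / 2 : ℝ))
    refine h4.congr_fderiv ?_
    ext w
    simp [hsymm w v]
    ring
  have key := (convex_segment 0 u).norm_image_sub_le_of_norm_hasFDerivWithin_le
    (f := φ) (C := M * ‖u‖ ^ 2) (fun v _ => (hφ v).hasFDerivWithinAt)
    (fun v hv => by
      refine (norm_taylor_one_le hd1 hM0 hM x v).trans ?_
      gcongr
      rw [segment_eq_image'] at hv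
      obtain ⟨θ, ⟨h0, h1⟩, rfl⟩ := hv
      simp only [sub_zero, zero_add, norm_smul, Real.norm_eq_abs, abs_of_nonneg h0]
      exact mul_le_of_le_one_left (norm_nonneg _) h1)
    (left_mem_segment ℝ _ _) (right_mem_segment ℝ _ _)
  have e : φ u - φ 0 = f (x + u) - f x - fderiv ℝ f x u - 1 / 2 * B u u := by
    simp [φ]; ring
  rw [e, Real.norm_eq_abs, sub_zero] at key
  calc _ ≤ _ := key
    _ = _ := by ring

/-- A function with bounded second derivative grows at most quadratically. -/
lemma abs_le_of_norm_fderiv_fderiv_le {f : E → ℝ} (hf : ContDiff ℝ 2 f) {M : ℝ} (hM0 : 0 ≤ M)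
    (hM : ∀ x, ‖fderiv ℝ (fderiv ℝ f) x‖ ≤ M) (x : E) :
    |f x| ≤ |f 0| + ‖fderiv ℝ f 0‖ * ‖x‖ + M * ‖x‖ ^ 2 := by
  have hd1 : Differentiable ℝ (fderiv ℝ f) :=
    (hf.fderiv_right (m := 1) (by norm_num)).differentiable (by norm_num)
  have h := norm_taylor_one_le (hf.differentiable (by norm_num)) hM0
    (fun x y => norm_sub_le_mul_norm_of_norm_fderiv_le hd1 hM y x) 0 x
  have h2 := (fderiv ℝ f 0).le_opNorm x
  rw [zero_add] at h
  rw [Real.norm_eq_abs] at h h2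
  have := abs_le.1 h
  have := abs_le.1 h2
  rcases abs_cases (f 0) with h3 | h3 <;> rw [abs_le] <;> constructor <;> linarith

end Taylor

/-! ### Integrability and decoupling of bounded variables -/

section Measure

variable {Ω : Type*} [MeasurableSpace Ω] {μ : Measure Ω}

lemma integrable_comp_of_bounded [IsFiniteMeasure μ] {F G : Type*} [NormedAddCommGroup F]
    [ProperSpace F] [MeasurableSpace F] [BorelSpace F]
    [NormedAddCommGroup G] [NormedSpace ℝ G] [SecondCountableTopology G]
    {Φ : F → G} (hΦ : Continuous Φ) {U : Ω → F} (hU : Measurable U) {C : ℝ}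
    (hC : ∀ ω, ‖U ω‖ ≤ C) : Integrable (fun ω => Φ (U ω)) μ := by
  borelize G
  obtain ⟨K, hK⟩ := ((isCompact_closedBall (0 : F) C).image hΦ).isBounded.exists_norm_le
  refine Integrable.of_bound (hΦ.measurable.comp hU).aestronglyMeasurable K
    (Filter.Eventually.of_forall fun ω => hK _ ⟨U ω, by simpa using hC ω, rfl⟩)

/-- Decoupling: two independent bounded variables may be integrated separately. -/
lemma integral_comp_prod_of_indepFun [IsProbabilityMeasure μ] {F F' : Type*}
    [NormedAddCommGroup F] [ProperSpace F] [SecondCountableTopology F]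
    [MeasurableSpace F] [BorelSpace F]
    [NormedAddCommGroup F'] [ProperSpace F'] [SecondCountableTopology F']
    [MeasurableSpace F'] [BorelSpace F']
    {U : Ω → F} {V : Ω → F'} (hUV : IndepFun U V μ) (hU : Measurable U) (hV : Measurable V)
    {C C' : ℝ} (hC : ∀ ω, ‖U ω‖ ≤ C) (hC' : ∀ ω, ‖V ω‖ ≤ C') {Φ : F × F' → ℝ}
    (hΦ : Continuous Φ) :
    ∫ ω, Φ (U ω, V ω) ∂μ = ∫ ω, ∫ ω', Φ (U ω', V ω) ∂μ ∂μ := by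
  have hlaw := hUV.map_prod_eq_prod_map_map hU.aemeasurable hV.aemeasurable
  have hswap : (μ.prod μ).map (fun q : Ω × Ω => (U q.2, V q.1)) = (μ.map U).prod (μ.map V) := by
    rw [Measure.map_prod_map μ μ hU hV]
    conv_rhs => rw [← Measure.prod_swap]
    rw [Measure.map_map (by fun_prop) (by fun_prop)]
    rfl
  have hmeas : Measurable (fun q : Ω × Ω => (U q.2, V q.1)) := by fun_prop
  calc ∫ ω, Φ (U ω, V ω) ∂μ = ∫ q, Φ q ∂(μ.map fun ω => (U ω, V ω)) := by
        rw [integral_map (by fun_prop) hΦ.aestronglyMeasurable]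
    _ = ∫ q, Φ q ∂((μ.prod μ).map (fun q : Ω × Ω => (U q.2, V q.1))) := by rw [hlaw, hswap]
    _ = ∫ q : Ω × Ω, Φ (U q.2, V q.1) ∂(μ.prod μ) := by
        rw [integral_map hmeas.aemeasurable hΦ.aestronglyMeasurable]
    _ = _ := by
        refine integral_prod _ ?_
        refine integrable_comp_of_bounded (C := max C C') hΦ hmeas fun q => ?_
        exact max_le_max (hC _) (hC' _)

end Measure

/-! ### The approximate Stein identity under local dependence -/

section LocalDependence

variable {Ω : Type*} [MeasurableSpace Ω] {μ : Measure Ω} [IsProbabilityMeasure μ]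
  {E : Type*} [NormedAddCommGroup E] [NormedSpace ℝ E] [FiniteDimensional ℝ E]
  [MeasurableSpace E] [BorelSpace E]

lemma abs_integral_le_of_abs_le {f : Ω → ℝ} {C : ℝ} (h : ∀ ω, |f ω| ≤ C) : |∫ ω, f ω ∂μ| ≤ C := by
  simpa using norm_integral_le_of_norm_le_const (μ := μ) (f := f)
    (Filter.Eventually.of_forall fun ω => by simpa using h ω)

lemma abs_apply_apply_le (B : E →L[ℝ] E →L[ℝ] ℝ) {u v : E} {c b b' : ℝ} (hB : ‖B‖ ≤ c)
    (hu : ‖u‖ ≤ b) (hv : ‖v‖ ≤ b') : |B u v| ≤ c * b * b' := by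
  have h0 : 0 ≤ c := (norm_nonneg B).trans hB
  have h1 : 0 ≤ b := (norm_nonneg _).trans hu
  calc |B u v| ≤ ‖B‖ * ‖u‖ * ‖v‖ := B.le_opNorm₂ u v
    _ ≤ _ := by gcongr

lemma integrable_apply_of_bounded {D : E → E →L[ℝ] ℝ} (hD : Continuous D) {U V : Ω → E}
    (hU : Measurable U) (hV : Measurable V) {C C' : ℝ} (hC : ∀ ω, ‖U ω‖ ≤ C)
    (hC' : ∀ ω, ‖V ω‖ ≤ C') : Integrable (fun ω => D (U ω) (V ω)) μ := by
  have := FiniteDimensional.proper ℝ E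
  exact integrable_comp_of_bounded (Φ := fun q : E × E => D q.1 q.2) (U := fun ω => (U ω, V ω))
    (by fun_prop) (by fun_prop) (C := max C C') fun ω => max_le_max (hC ω) (hC' ω)

lemma integrable_apply_apply_of_bounded {D : E → E →L[ℝ] E →L[ℝ] ℝ} (hD : Continuous D)
    {U V V' : Ω → E} (hU : Measurable U) (hV : Measurable V) (hV' : Measurable V') {C C' C'' : ℝ}
    (hC : ∀ ω, ‖U ω‖ ≤ C) (hC' : ∀ ω, ‖V ω‖ ≤ C') (hC'' : ∀ ω, ‖V' ω‖ ≤ C'') :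
    Integrable (fun ω => D (U ω) (V ω) (V' ω)) μ := by
  have := FiniteDimensional.proper ℝ E
  exact integrable_comp_of_bounded (Φ := fun q : E × E × E => D q.1 q.2.1 q.2.2)
    (U := fun ω => (U ω, V ω, V' ω)) (by fun_prop) (by fun_prop) (C := max C (max C' C''))
    fun ω => max_le_max (hC ω) (max_le_max (hC' ω) (hC'' ω))

/-- Removing the part of `V + R` that depends on the mean-zero variable `ξ`: first order. -/
lemma abs_integral_apply_sub_le {D₁ : E → E →L[ℝ] ℝ} {D₂ : E → E →L[ℝ] E →L[ℝ] ℝ}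
    (hD₁ : Continuous D₁) (hD₂ : Continuous D₂) {M : ℝ} (hM : 0 ≤ M)
    (hT : ∀ x u, ‖D₁ (x + u) - D₁ x - D₂ x u‖ ≤ M * ‖u‖ ^ 2)
    {ξ V R : Ω → E} (hξ : Measurable ξ) (hV : Measurable V) (hR : Measurable R) {b C ρ : ℝ}
    (hξb : ∀ ω, ‖ξ ω‖ ≤ b) (hVC : ∀ ω, ‖V ω‖ ≤ C) (hRρ : ∀ ω, ‖R ω‖ ≤ ρ)
    (hmean : ∫ ω, ξ ω ∂μ = 0) (hind : IndepFun ξ V μ) (s : ℝ) (y : E) :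
    |(∫ ω, D₁ (s • (V ω + R ω) + y) (ξ ω) ∂μ)
      - s * ∫ ω, D₂ (s • (V ω + R ω) + y) (R ω) (ξ ω) ∂μ| ≤ M * s ^ 2 * ρ ^ 2 * b := by
  have := FiniteDimensional.proper ℝ E
  have hVR : Measurable fun ω => V ω + R ω := hV.add hR
  have hWC : ∀ ω, ‖V ω + R ω‖ ≤ C + ρ := fun ω => norm_add_le_of_le (hVC ω) (hRρ ω)
  have hzero : ∫ ω, D₁ (s • V ω + y) (ξ ω) ∂μ = 0 := by
    rw [integral_comp_prod_of_indepFun hind hξ hV hξb hVC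
      (Φ := fun q : E × E => D₁ (s • q.2 + y) q.1) (by fun_prop)]
    have hint : Integrable ξ μ := integrable_comp_of_bounded continuous_id hξ hξb
    simp [ContinuousLinearMap.integral_comp_comm _ hint, hmean]
  have i1 : Integrable (fun ω => D₁ (s • (V ω + R ω) + y) (ξ ω)) μ :=
    integrable_apply_of_bounded (D := fun x => D₁ (s • x + y)) (by fun_prop)
      hVR hξ hWC hξb
  have i2 : Integrable (fun ω => D₁ (s • V ω + y) (ξ ω)) μ :=
    integrable_apply_of_bounded (D := fun x => D₁ (s • x + y)) (by fun_prop) hV hξ hVC hξb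
  have i3 : Integrable (fun ω => D₂ (s • (V ω + R ω) + y) (R ω) (ξ ω)) μ :=
    integrable_apply_apply_of_bounded (D := fun x => D₂ (s • x + y)) (by fun_prop)
      hVR hR hξ hWC hRρ hξb
  have i12 : Integrable
      (fun ω => D₁ (s • (V ω + R ω) + y) (ξ ω) - D₁ (s • V ω + y) (ξ ω)) μ := i1.sub i2
  rw [← sub_zero (∫ ω, D₁ (s • (V ω + R ω) + y) (ξ ω) ∂μ), ← hzero, ← integral_const_mul,
    ← integral_sub i1 i2, ← integral_sub i12 (i3.const_mul s)]
  refine abs_integral_le_of_abs_le fun ω => ?_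
  -- The expansion goes backwards from the full sum, so that `D₂` is evaluated at the full sum and
  -- not at `V`.
  have h := hT (s • (V ω + R ω) + y) (-(s • R ω))
  have e : s • (V ω + R ω) + y + -(s • R ω) = s • V ω + y := by rw [smul_add]; abel
  rw [e] at h
  have e2 : D₁ (s • (V ω + R ω) + y) (ξ ω) - D₁ (s • V ω + y) (ξ ω)
      - s * D₂ (s • (V ω + R ω) + y) (R ω) (ξ ω)
      = -((D₁ (s • V ω + y) - D₁ (s • (V ω + R ω) + y)
        - D₂ (s • (V ω + R ω) + y) (-(s • R ω))) (ξ ω)) := by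
    simp; ring
  rw [e2, abs_neg]
  have hρ : 0 ≤ ρ := (norm_nonneg _).trans (hRρ ω)
  have hb : 0 ≤ b := (norm_nonneg _).trans (hξb ω)
  have h2 : M * ‖-(s • R ω)‖ ^ 2 ≤ M * s ^ 2 * ρ ^ 2 := by
    rw [norm_neg, norm_smul, mul_pow, Real.norm_eq_abs, sq_abs, ← mul_assoc]
    gcongr
    exact hRρ ω
  exact (ContinuousLinearMap.le_of_opNorm_le _ (h.trans h2) _).trans
    (mul_le_mul_of_nonneg_left (hξb ω) (by positivity))

/-- Decoupling of a pair of variables from `V + R`, where the pair is independent of `V`. -/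
lemma abs_integral_apply_apply_sub_le {D : E → E →L[ℝ] E →L[ℝ] ℝ}
    (hD : Continuous D) {M : ℝ} (hM : 0 ≤ M) (hL : ∀ x y, ‖D x - D y‖ ≤ M * ‖x - y‖)
    {ξ ξ' V R : Ω → E} (hξ : Measurable ξ) (hξ' : Measurable ξ') (hV : Measurable V)
    (hR : Measurable R) {b C ρ : ℝ} (hξb : ∀ ω, ‖ξ ω‖ ≤ b) (hξb' : ∀ ω, ‖ξ' ω‖ ≤ b)
    (hVC : ∀ ω, ‖V ω‖ ≤ C) (hRρ : ∀ ω, ‖R ω‖ ≤ ρ)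
    (hind : IndepFun (fun ω => (ξ ω, ξ' ω)) V μ) {s : ℝ} (hs : 0 ≤ s) (y : E) :
    |(∫ ω, D (s • (V ω + R ω) + y) (ξ ω) (ξ' ω) ∂μ)
      - ∫ ω, ∫ ω', D (s • (V ω + R ω) + y) (ξ ω') (ξ' ω') ∂μ ∂μ| ≤ 2 * (M * s * ρ * b ^ 2) := by
  have := FiniteDimensional.proper ℝ E
  have hVR : Measurable fun ω => V ω + R ω := hV.add hR
  have hWC : ∀ ω, ‖V ω + R ω‖ ≤ C + ρ := fun ω => norm_add_le_of_le (hVC ω) (hRρ ω)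
  -- Cost of replacing `V + R` by `V`. It is paid twice, once with the pair coupled to `V` and once
  -- with an independent pair, whence the factor 2.
  have key : ∀ ω u v, ‖u‖ ≤ b → ‖v‖ ≤ b →
      |D (s • (V ω + R ω) + y) u v - D (s • V ω + y) u v| ≤ M * s * ρ * b ^ 2 := by
    intro ω u v hu hv
    have h := hL (s • (V ω + R ω) + y) (s • V ω + y)
    have e : s • (V ω + R ω) + y - (s • V ω + y) = s • R ω := by rw [smul_add]; abel
    rw [e, norm_smul, Real.norm_eq_abs, abs_of_nonneg hs] at h
    have h' := abs_apply_apply_le _ (c := M * (s * ρ))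
      (h.trans (by gcongr; exact hRρ ω)) hu hv
    simp only [_root_.sub_apply] at h'
    linarith
  have i1 := integrable_apply_apply_of_bounded (μ := μ) (D := fun x => D (s • x + y)) (by fun_prop)
      hVR hξ hξ' hWC hξb hξb'
  have i2 := integrable_apply_apply_of_bounded (μ := μ) (D := fun x => D (s • x + y)) (by fun_prop)
      hV hξ hξ' hVC hξb hξb'
  have j : ∀ {U : Ω → E} {C : ℝ}, Measurable U → (∀ ω, ‖U ω‖ ≤ C) →
      Integrable (fun q : Ω × Ω => D (s • U q.1 + y) (ξ q.2) (ξ' q.2)) (μ.prod μ) :=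
    fun hU hC => integrable_apply_apply_of_bounded (D := fun x => D (s • x + y)) (by fun_prop)
      (hU.comp measurable_fst) (hξ.comp measurable_snd) (hξ'.comp measurable_snd)
      (fun q => hC q.1) (fun q => hξb q.2) (fun q => hξb' q.2)
  have j1 := (j hVR hWC).integral_prod_left
  have j2 := (j hV hVC).integral_prod_left
  have jj1 : ∀ ω, Integrable (fun ω' => D (s • (V ω + R ω) + y) (ξ ω') (ξ' ω')) μ := fun ω =>
    integrable_apply_apply_of_bounded (U := fun _ => V ω + R ω) (D := fun x => D (s • x + y))
      (by fun_prop) (by fun_prop) hξ hξ' (fun _ => le_rfl) hξb hξb'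
  have jj2 : ∀ ω, Integrable (fun ω' => D (s • V ω + y) (ξ ω') (ξ' ω')) μ := fun ω =>
    integrable_apply_apply_of_bounded (U := fun _ => V ω) (D := fun x => D (s • x + y))
      (by fun_prop) (by fun_prop) hξ hξ' (fun _ => le_rfl) hξb hξb'
  have hdec : ∫ ω, D (s • V ω + y) (ξ ω) (ξ' ω) ∂μ
      = ∫ ω, ∫ ω', D (s • V ω + y) (ξ ω') (ξ' ω') ∂μ ∂μ :=
    integral_comp_prod_of_indepFun (C := max b b) hind (hξ.prodMk hξ') hV
      (fun ω => max_le_max (hξb ω) (hξb' ω)) hVC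
      (Φ := fun q : (E × E) × E => D (s • q.2 + y) q.1.1 q.1.2) (by fun_prop)
  have a1 : |(∫ ω, D (s • (V ω + R ω) + y) (ξ ω) (ξ' ω) ∂μ)
      - ∫ ω, D (s • V ω + y) (ξ ω) (ξ' ω) ∂μ| ≤ M * s * ρ * b ^ 2 := by
    rw [← integral_sub i1 i2]
    exact abs_integral_le_of_abs_le fun ω => key ω _ _ (hξb ω) (hξb' ω)
  have a2 : |(∫ ω, ∫ ω', D (s • (V ω + R ω) + y) (ξ ω') (ξ' ω') ∂μ ∂μ)
      - ∫ ω, ∫ ω', D (s • V ω + y) (ξ ω') (ξ' ω') ∂μ ∂μ| ≤ M * s * ρ * b ^ 2 := by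
    rw [← integral_sub j1 j2]
    refine abs_integral_le_of_abs_le fun ω => ?_
    rw [← integral_sub (jj1 ω) (jj2 ω)]
    exact abs_integral_le_of_abs_le fun ω' => key ω _ _ (hξb ω') (hξb' ω')
  rw [hdec] at a1
  rw [abs_sub_comm] at a2
  calc _ ≤ _ := abs_sub_le _ _ _
    _ ≤ _ := add_le_add a1 a2
    _ = _ := by ring

variable {ι : Type*} [Fintype ι] [DecidableEq ι]

/-- A finite family of bounded, centred, locally dependent random vectors. -/
structure LocallyDependent (μ : Measure Ω) (ξ : ι → Ω → E) (N : ι → Finset ι) (b K : ℝ) :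
    Prop where
  measurable : ∀ m, Measurable (ξ m)
  norm_le : ∀ m ω, ‖ξ m ω‖ ≤ b
  integral_eq_zero : ∀ m, ∫ ω, ξ m ω ∂μ = 0
  card_le : ∀ m, ((N m).card : ℝ) ≤ K
  indep : ∀ m, IndepFun (ξ m) (fun ω => ∑ j ∈ (N m)ᶜ, ξ j ω) μ
  indep_pair : ∀ m, ∀ m' ∈ N m,
    IndepFun (fun ω => (ξ m' ω, ξ m ω)) (fun ω => ∑ j ∈ (N m ∪ N m')ᶜ, ξ j ω) μ

namespace LocallyDependent

variable {ξ : ι → Ω → E} {N : ι → Finset ι} {b K : ℝ}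

lemma norm_sum_le (h : LocallyDependent μ ξ N b K) (s : Finset ι) (ω : Ω) :
    ‖∑ j ∈ s, ξ j ω‖ ≤ s.card * b := by
  simpa using norm_sum_le_of_le s (f := fun j => ξ j ω) (n := fun _ => b) fun j _ => h.norm_le j ω

lemma measurable_sum (h : LocallyDependent μ ξ N b K) (s : Finset ι) :
    Measurable (fun ω => ∑ j ∈ s, ξ j ω) :=
  Finset.measurable_sum s fun j _ => h.measurable j

/-- Only neighbouring pairs contribute, since `ξ m` is centred and independent of the sum over the
complement of `N m`. -/
lemma integral_bilin_sum (h : LocallyDependent μ ξ N b K) (B : E →L[ℝ] E →L[ℝ] ℝ) :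
    ∫ ω, B (∑ j, ξ j ω) (∑ j, ξ j ω) ∂μ = ∑ m, ∑ m' ∈ N m, ∫ ω, B (ξ m' ω) (ξ m ω) ∂μ := by
  have := FiniteDimensional.proper ℝ E
  have hint : ∀ (U V : Ω → E), Measurable U → Measurable V → ∀ {C C' : ℝ}, (∀ ω, ‖U ω‖ ≤ C) →
      (∀ ω, ‖V ω‖ ≤ C') → Integrable (fun ω => B (U ω) (V ω)) μ :=
    fun U V hU hV _ _ hC hC' => integrable_apply_of_bounded B.continuous hU hV hC hC'
  simp only [map_sum]
  rw [integral_finsetSum _ fun m _ => ?_]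
  swap
  · simpa using hint _ _ (h.measurable_sum _) (h.measurable m) (h.norm_sum_le _) (h.norm_le m)
  refine Finset.sum_congr rfl fun m _ => ?_
  have hzero : ∫ ω, B (∑ j ∈ (N m)ᶜ, ξ j ω) (ξ m ω) ∂μ = 0 := by
    rw [integral_comp_prod_of_indepFun (h.indep m) (h.measurable m) (h.measurable_sum _)
      (h.norm_le m) (h.norm_sum_le _) (Φ := fun q : E × E => B q.2 q.1) (by fun_prop)]
    have hi : Integrable (ξ m) μ :=
      integrable_comp_of_bounded continuous_id (h.measurable m) (h.norm_le m)
    simp [-map_sum, ContinuousLinearMap.integral_comp_comm _ hi, h.integral_eq_zero m]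
  have e : ∀ ω, B (∑ j, ξ j ω) (ξ m ω)
      = B (∑ j ∈ N m, ξ j ω) (ξ m ω) + B (∑ j ∈ (N m)ᶜ, ξ j ω) (ξ m ω) := fun ω => by
    rw [← Finset.sum_add_sum_compl (N m), map_add, _root_.add_apply]
  simp only [← map_sum, e]
  rw [integral_add (hint _ _ (h.measurable_sum _) (h.measurable m) (h.norm_sum_le _) (h.norm_le m))
    (hint _ _ (h.measurable_sum _) (h.measurable m) (h.norm_sum_le _) (h.norm_le m)), hzero,
    add_zero]
  simp only [map_sum, _root_.sum_apply]
  exact integral_finsetSum _ fun m' _ => hint _ _ (h.measurable m') (h.measurable m)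
    (h.norm_le m') (h.norm_le m)

/-- The approximate Stein identity for a sum of locally dependent variables. -/
theorem abs_integral_sub_le (h : LocallyDependent μ ξ N b K) {D₁ : E → E →L[ℝ] ℝ}
    {D₂ : E → E →L[ℝ] E →L[ℝ] ℝ} (hD₁ : Continuous D₁) (hD₂ : Continuous D₂) {M : ℝ} (hM : 0 ≤ M)
    (hT : ∀ x u, ‖D₁ (x + u) - D₁ x - D₂ x u‖ ≤ M * ‖u‖ ^ 2)
    (hL : ∀ x y, ‖D₂ x - D₂ y‖ ≤ M * ‖x - y‖) (hb : 0 ≤ b) {s : ℝ} (hs : 0 ≤ s) (y : E) :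
    |(∫ ω, D₁ (s • (∑ j, ξ j ω) + y) (∑ j, ξ j ω) ∂μ)
      - s * ∫ ω, ∫ ω', D₂ (s • (∑ j, ξ j ω) + y) (∑ j, ξ j ω') (∑ j, ξ j ω') ∂μ ∂μ|
      ≤ 5 * Fintype.card ι * K ^ 2 * b ^ 3 * M * s ^ 2 := by
  have hW := h.measurable_sum Finset.univ
  have hWb := h.norm_sum_le Finset.univ
  have hsub : ∀ m, ∀ ω, ‖∑ j ∈ N m, ξ j ω‖ ≤ K * b := fun m ω =>
    (h.norm_sum_le _ ω).trans (by gcongr; exact h.card_le m)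
  have hunion : ∀ m m', ∀ ω, ‖∑ j ∈ N m ∪ N m', ξ j ω‖ ≤ 2 * K * b := fun m m' ω => by
    refine (h.norm_sum_le _ ω).trans ?_
    gcongr
    have h1 : ((N m ∪ N m').card : ℝ) ≤ (N m).card + (N m').card := by
      exact_mod_cast Finset.card_union_le _ _
    linarith [h.card_le m, h.card_le m']
  have hsplit : ∀ (s : Finset ι) ω, ∑ j, ξ j ω = ∑ j ∈ sᶜ, ξ j ω + ∑ j ∈ s, ξ j ω := fun s ω => by
    rw [add_comm, Finset.sum_add_sum_compl]
  set A : ι → ℝ := fun m => ∫ ω, D₁ (s • (∑ j, ξ j ω) + y) (ξ m ω) ∂μ with hA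
  set B : ι → ι → ℝ := fun m m' => ∫ ω, D₂ (s • (∑ j, ξ j ω) + y) (ξ m' ω) (ξ m ω) ∂μ with hB
  set C : ι → ι → ℝ := fun m m' =>
    ∫ ω, ∫ ω', D₂ (s • (∑ j, ξ j ω) + y) (ξ m' ω') (ξ m ω') ∂μ ∂μ with hC
  have e1 : ∫ ω, D₁ (s • (∑ j, ξ j ω) + y) (∑ j, ξ j ω) ∂μ = ∑ m, A m := by
    simp only [hA]
    rw [← integral_finsetSum]
    · simp only [← map_sum]
    · exact fun m _ => integrable_apply_of_bounded (D := fun x => D₁ (s • x + y)) (by fun_prop)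
        hW (h.measurable m) hWb (h.norm_le m)
  have e2 : ∫ ω, ∫ ω', D₂ (s • (∑ j, ξ j ω) + y) (∑ j, ξ j ω') (∑ j, ξ j ω') ∂μ ∂μ
      = ∑ m, ∑ m' ∈ N m, C m m' := by
    have hi : ∀ m m', Integrable
        (fun ω => ∫ ω', D₂ (s • (∑ j, ξ j ω) + y) (ξ m' ω') (ξ m ω') ∂μ) μ := fun m m' =>
      (integrable_apply_apply_of_bounded (μ := μ.prod μ) (D := fun x => D₂ (s • x + y))
        (by fun_prop) (hW.comp measurable_fst) ((h.measurable m').comp measurable_snd)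
        ((h.measurable m).comp measurable_snd) (fun q => hWb q.1) (fun q => h.norm_le m' q.2)
        (fun q => h.norm_le m q.2)).integral_prod_left
    simp only [h.integral_bilin_sum, hC]
    rw [integral_finsetSum _ fun m _ => integrable_finsetSum _ fun m' _ => hi m m']
    exact Finset.sum_congr rfl fun m _ => integral_finsetSum _ fun m' _ => hi m m'
  have b1 : ∀ m, |A m - s * ∑ m' ∈ N m, B m m'| ≤ M * s ^ 2 * (K * b) ^ 2 * b := fun m => by
    have key := abs_integral_apply_sub_le hD₁ hD₂ hM hT (h.measurable m)
      (h.measurable_sum (N m)ᶜ) (h.measurable_sum (N m)) (h.norm_le m) (h.norm_sum_le _) (hsub m)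
      (h.integral_eq_zero m) (h.indep m) s y
    simp only [← hsplit] at key
    have e : ∫ ω, D₂ (s • (∑ j, ξ j ω) + y) (∑ j ∈ N m, ξ j ω) (ξ m ω) ∂μ
        = ∑ m' ∈ N m, B m m' := by
      simp only [hB]
      rw [← integral_finsetSum]
      · refine integral_congr_ae (Filter.Eventually.of_forall fun ω => ?_)
        simp only [map_sum, _root_.sum_apply]
      · exact fun m' _ => integrable_apply_apply_of_bounded (D := fun x => D₂ (s • x + y))
          (by fun_prop) hW (h.measurable m') (h.measurable m) hWb (h.norm_le m') (h.norm_le m)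
    rwa [e] at key
  have b2 : ∀ m, ∀ m' ∈ N m, |B m m' - C m m'| ≤ 2 * (M * s * (2 * K * b) * b ^ 2) :=
    fun m m' hm' => by
      have key := abs_integral_apply_apply_sub_le hD₂ hM hL (h.measurable m') (h.measurable m)
        (h.measurable_sum (N m ∪ N m')ᶜ) (h.measurable_sum (N m ∪ N m')) (h.norm_le m')
        (h.norm_le m) (h.norm_sum_le _) (hunion m m') (h.indep_pair m m' hm') hs y
      simpa only [← hsplit] using key
  -- Here 5 = 1 + 4: one from `b1`, and four from at most `K` uses of `b2`, each with a factor 2 for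
  -- decoupling and `2 * K` for the two neighbourhoods.
  have b3 : ∀ m, |A m - s * ∑ m' ∈ N m, C m m'| ≤ 5 * K ^ 2 * b ^ 3 * M * s ^ 2 := fun m => by
    have hK : 0 ≤ K := (Nat.cast_nonneg _).trans (h.card_le m)
    have h2 : |∑ m' ∈ N m, B m m' - ∑ m' ∈ N m, C m m'|
        ≤ K * (2 * (M * s * (2 * K * b) * b ^ 2)) := by
      rw [← Finset.sum_sub_distrib]
      refine (Finset.abs_sum_le_sum_abs _ _).trans ((Finset.sum_le_sum (b2 m)).trans ?_)
      rw [Finset.sum_const, nsmul_eq_mul]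
      gcongr
      exact h.card_le m
    have e : A m - s * ∑ m' ∈ N m, C m m' = (A m - s * ∑ m' ∈ N m, B m m')
        + s * (∑ m' ∈ N m, B m m' - ∑ m' ∈ N m, C m m') := by ring
    rw [e]
    calc _ ≤ _ := abs_add_le _ _
      _ ≤ M * s ^ 2 * (K * b) ^ 2 * b + s * (K * (2 * (M * s * (2 * K * b) * b ^ 2))) := by
        rw [abs_mul, abs_of_nonneg hs]
        gcongr
        exact b1 m
      _ = _ := by ring
  rw [e1, e2, Finset.mul_sum, ← Finset.sum_sub_distrib]
  calc _ ≤ _ := Finset.abs_sum_le_sum_abs _ _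
    _ ≤ ∑ _m : ι, 5 * K ^ 2 * b ^ 3 * M * s ^ 2 := Finset.sum_le_sum fun m _ => b3 m
    _ = _ := by rw [Finset.sum_const, nsmul_eq_mul, Finset.card_univ]; ring


end LocallyDependent

end LocalDependence

/-! ### One interpolation step -/

section Interpolation

variable {E : Type*} [NormedAddCommGroup E] [NormedSpace ℝ E] [FiniteDimensional ℝ E]
  [MeasurableSpace E] [BorelSpace E]

/-- A bounded second derivative forces at most quadratic growth, so a square-integrable argument
suffices. -/
lemma integrable_comp_of_norm_fderiv_fderiv_le {f : E → ℝ} (hf : ContDiff ℝ 2 f) {M : ℝ}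
    (hM0 : 0 ≤ M) (hM : ∀ x, ‖fderiv ℝ (fderiv ℝ f) x‖ ≤ M) {T : Type*} [MeasurableSpace T]
    {ν : Measure T} [IsFiniteMeasure ν] {V : T → E} (hV : MemLp V 2 ν) :
    Integrable (fun t => f (V t)) ν := by
  have h1 : Integrable (fun t => ‖V t‖) ν := (hV.integrable (by norm_num)).norm
  have h2 : Integrable (fun t => ‖V t‖ ^ 2) ν := hV.integrable_norm_pow two_ne_zero
  refine Integrable.mono' (((integrable_const |f 0|).add (h1.const_mul ‖fderiv ℝ f 0‖)).add
    (h2.const_mul M)) (hf.continuous.comp_aestronglyMeasurable hV.1)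
    (Filter.Eventually.of_forall fun t => abs_le_of_norm_fderiv_fderiv_le hf hM0 hM (V t))

/-- A centred Gaussian measure is stable: `s' z + r z'` has the law of `s z` when
`s ^ 2 = s' ^ 2 + r ^ 2`. -/
lemma map_smul_add_smul_of_isGaussian {γ : Measure E} [IsGaussian γ] (hγ : γ[id] = 0)
    {s s' r : ℝ} (hs : 0 ≤ s) (hs' : 0 ≤ s') (h : s ^ 2 = s' ^ 2 + r ^ 2) :
    (γ.prod γ).map (fun q : E × E => s' • q.1 + r • q.2) = γ.map (fun z => s • z) := by
  have := FiniteDimensional.complete ℝ E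
  rcases hs.eq_or_lt with rfl | hs
  · have h1 : s' = 0 := by nlinarith [sq_nonneg s', sq_nonneg r]
    have h2 : r = 0 := by nlinarith [sq_nonneg s', sq_nonneg r]
    simp [h1, h2, Measure.map_const]
  · have hr : (r / s) ^ 2 ≤ 1 := by
      rw [div_pow, div_le_one (by positivity)]
      nlinarith [sq_nonneg s']
    -- The pair `(s' / s, r / s)` lies on the unit circle, so the combination is `s` times a
    -- coordinate of a rotation, and `γ.prod γ` is rotation invariant.
    have hsin : Real.sin (Real.arcsin (r / s)) = r / s :=
      Real.sin_arcsin (by nlinarith [sq_abs (r / s)]) (by nlinarith)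
    have hcos : Real.cos (Real.arcsin (r / s)) = s' / s := by
      rw [Real.cos_arcsin, Real.sqrt_eq_iff_mul_self_eq (by linarith) (by positivity)]
      field_simp
      linarith
    have hrot := IsGaussian.map_rotation_eq_self hγ (Real.arcsin (r / s))
    have e : (fun q : E × E => s' • q.1 + r • q.2)
        = (fun z : E => s • z) ∘ Prod.fst ∘ ContinuousLinearMap.rotation (Real.arcsin (r / s)) := by
      ext q
      simp only [Function.comp, ContinuousLinearMap.rotation_apply, hsin, hcos, smul_add, smul_smul]
      congr 2 <;> field_simp
    rw [e, ← Measure.map_map (by fun_prop) (by fun_prop),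
      ← Measure.map_map (by fun_prop) (by fun_prop), hrot]
    simp

variable {Ω : Type*} [MeasurableSpace Ω] {μ : Measure Ω} [IsProbabilityMeasure μ]
  {γ : Measure E} [IsGaussian γ]

/-- One step of the interpolation: move the weight of `W` from `a` to `a'` at the expense of a
Gaussian increment of the same variance. -/
lemma abs_interpolation_step_le {f : E → ℝ} (hf : ContDiff ℝ 2 f) {M₂ M₃ : ℝ} (hM₂0 : 0 ≤ M₂)
    (hM₃0 : 0 ≤ M₃) (hM₂ : ∀ x, ‖fderiv ℝ (fderiv ℝ f) x‖ ≤ M₂)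
    (hM₃ : ∀ x y, ‖fderiv ℝ (fderiv ℝ f) x - fderiv ℝ (fderiv ℝ f) y‖ ≤ M₃ * ‖x - y‖)
    {W : Ω → E} (hW : Measurable W) {c : ℝ} (hWc : ∀ ω, ‖W ω‖ ≤ c) (hγ : γ[id] = 0)
    (hcov : ∀ B : E →L[ℝ] E →L[ℝ] ℝ, ∫ z, B z z ∂γ = ∫ ω, B (W ω) (W ω) ∂μ) {A : ℝ}
    {a a' r : ℝ} (ha : 0 ≤ a) (haa' : a ≤ a') (ha' : a' ≤ 1) (hr0 : 0 ≤ r)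
    (hr : r ^ 2 = a' ^ 2 - a ^ 2) (hA0 : 0 ≤ A) (y : E)
    (hA : |(∫ ω, fderiv ℝ f (a • W ω + y) (W ω) ∂μ)
      - a * ∫ ω, ∫ ω', fderiv ℝ (fderiv ℝ f) (a • W ω + y) (W ω') (W ω') ∂μ ∂μ| ≤ A * a ^ 2) :
    |(∫ ω, f (a' • W ω + y) ∂μ) - ∫ ω, ∫ z, f (a • W ω + y + r • z) ∂γ ∂μ|
      ≤ r ^ 2 * (A / 2) + r * (a' - a) * (M₂ * c ^ 2)
        + r * r ^ 2 * (M₃ * (c ^ 3 + ∫ z, ‖z‖ ^ 3 ∂γ)) := by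
  have := FiniteDimensional.proper ℝ E
  have := FiniteDimensional.complete ℝ E
  have hc : 0 ≤ c := by
    obtain ⟨ω⟩ := μ.nonempty_of_neZero
    exact (norm_nonneg _).trans (hWc ω)
  set η := a' - a with hη
  have hη0 : 0 ≤ η := by simp [hη, haa']
  -- This absorbs the powers of the weight increment `η` into those of the Gaussian scale `r`.
  have hηr : η ≤ r := by
    apply le_of_sq_le_sq _ hr0
    rw [hr, hη]; nlinarith
  set D₁ := fderiv ℝ f with hD₁
  set D₂ := fderiv ℝ D₁ with hD₂
  have hcd : ContDiff ℝ 1 D₁ := hf.fderiv_right (by norm_num)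
  have c0 : Continuous f := hf.continuous
  have c1 : Continuous D₁ := hcd.continuous
  have c2 : Continuous D₂ := hcd.continuous_fderiv (by norm_num)
  have mz : ∀ k : ℕ, MemLp (id : E → E) k γ := fun k =>
    IsGaussian.memLp_id γ k (by simp)
  have iz3 : Integrable (fun z : E => ‖z‖ ^ 3) γ := (mz 3).integrable_norm_pow (by norm_num)
  have iz : Integrable (fun z : E => z) γ := IsGaussian.integrable_id
  have izB : ∀ B : E →L[ℝ] E →L[ℝ] ℝ, Integrable (fun z => B z z) γ := fun B => by
    refine Integrable.mono' (((mz 2).integrable_norm_pow (by norm_num)).const_mul ‖B‖)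
      (by fun_prop) (Filter.Eventually.of_forall fun z => ?_)
    refine (B.le_opNorm₂ z z).trans (le_of_eq ?_)
    simp; ring
  set q : E → ℝ := fun x => ∫ ω', D₂ x (W ω') (W ω') ∂μ with hq
  -- the Gaussian side
  have hG : ∀ x, |(∫ z, f (x + r • z) ∂γ) - (f x + r ^ 2 / 2 * q x)|
      ≤ M₃ * r ^ 3 * ∫ z, ‖z‖ ^ 3 ∂γ := fun x => by
    have i0 : Integrable (fun z => f (x + r • z)) γ :=
      integrable_comp_of_norm_fderiv_fderiv_le hf hM₂0 hM₂
        ((memLp_const x).add ((mz 2).const_smul r))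
    have i1 : Integrable (fun z => D₁ x (r • z)) γ := (D₁ x).integrable_comp (iz.smul r)
    have i2 : Integrable (fun z => 1 / 2 * D₂ x (r • z) (r • z)) γ := by
      simpa [mul_assoc] using (((izB (D₂ x)).const_mul (r)).const_mul r).const_mul (1 / 2)
    have izr : Integrable (fun z : E => r • z) γ := iz.smul r
    have e1 : ∫ z, D₁ x (r • z) ∂γ = 0 := by
      rw [(D₁ x).integral_comp_comm izr, integral_smul]
      have : ∫ z, z ∂γ = 0 := hγ
      simp [this]
    have e2 : ∫ z, 1 / 2 * D₂ x (r • z) (r • z) ∂γ = r ^ 2 / 2 * q x := by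
      simp only [map_smul, _root_.smul_apply, smul_eq_mul, integral_const_mul, hcov, hq]
      ring
    have e3 : ∫ z, (f (x + r • z) - f x - D₁ x (r • z) - 1 / 2 * D₂ x (r • z) (r • z)) ∂γ
        = (∫ z, f (x + r • z) ∂γ) - (f x + r ^ 2 / 2 * q x) := by
      rw [integral_sub (by exact (i0.sub (integrable_const _)).sub i1) i2,
        integral_sub (by exact i0.sub (integrable_const _)) i1,
        integral_sub i0 (integrable_const _), e1, e2]
      simp
      ring
    rw [← e3, mul_assoc, ← integral_const_mul, ← integral_const_mul, ← Real.norm_eq_abs]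
    refine norm_integral_le_of_norm_le ((iz3.const_mul _).const_mul _)
      (Filter.Eventually.of_forall fun z => ?_)
    refine (abs_taylor_two_le hf hM₃0 hM₃ x (r • z)).trans (le_of_eq ?_)
    rw [norm_smul, Real.norm_eq_abs, abs_of_nonneg hr0]; ring
  -- integrability on the side of `W`
  have k0 : Integrable (fun ω => f (a • W ω + y)) μ :=
    integrable_comp_of_bounded (Φ := fun x => f (a • x + y)) (by fun_prop) hW hWc
  have k0' : Integrable (fun ω => f (a' • W ω + y)) μ :=
    integrable_comp_of_bounded (Φ := fun x => f (a' • x + y)) (by fun_prop) hW hWc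
  have k1 : Integrable (fun ω => D₁ (a • W ω + y) (W ω)) μ :=
    integrable_apply_of_bounded (D := fun x => D₁ (a • x + y)) (by fun_prop) hW hW hWc hWc
  have k2 : Integrable (fun ω => D₂ (a • W ω + y) (W ω) (W ω)) μ :=
    integrable_apply_apply_of_bounded (D := fun x => D₂ (a • x + y)) (by fun_prop) hW hW hW
      hWc hWc hWc
  have kq : Integrable (fun ω => q (a • W ω + y)) μ :=
    (integrable_apply_apply_of_bounded (μ := μ.prod μ) (D := fun x => D₂ (a • x + y))
      (by fun_prop) (hW.comp measurable_fst) (hW.comp measurable_snd) (hW.comp measurable_snd)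
      (fun p => hWc p.1) (fun p => hWc p.2) (fun p => hWc p.2)).integral_prod_left
  have kG : Integrable (fun ω => ∫ z, f (a • W ω + y + r • z) ∂γ) μ := by
    have hWL : MemLp W 2 μ :=
      MemLp.of_bound hW.aestronglyMeasurable c (Filter.Eventually.of_forall hWc)
    have h1 : MemLp (fun p : Ω × E => a • W p.1 + y + r • p.2) 2 (μ.prod γ) :=
      (((hWL.comp_fst γ).const_smul a).add (memLp_const y)).add
        (((mz 2).comp_snd μ).const_smul r)
    exact (integrable_comp_of_norm_fderiv_fderiv_le hf hM₂0 hM₂ h1).integral_prod_left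
  have hqb : ∀ x, |q x| ≤ M₂ * c * c := fun x =>
    abs_integral_le_of_abs_le fun ω => abs_apply_apply_le _ (hM₂ x) (hWc ω) (hWc ω)
  have t1 : |(∫ ω, f (a' • W ω + y) ∂μ) - ((∫ ω, f (a • W ω + y) ∂μ)
      + η * (∫ ω, D₁ (a • W ω + y) (W ω) ∂μ)
      + η ^ 2 / 2 * ∫ ω, D₂ (a • W ω + y) (W ω) (W ω) ∂μ)| ≤ M₃ * η ^ 3 * c ^ 3 := by
    have e : ∫ ω, (f (a' • W ω + y) - (f (a • W ω + y) + η * D₁ (a • W ω + y) (W ω)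
        + η ^ 2 / 2 * D₂ (a • W ω + y) (W ω) (W ω))) ∂μ
        = (∫ ω, f (a' • W ω + y) ∂μ) - ((∫ ω, f (a • W ω + y) ∂μ)
          + η * (∫ ω, D₁ (a • W ω + y) (W ω) ∂μ)
          + η ^ 2 / 2 * ∫ ω, D₂ (a • W ω + y) (W ω) (W ω) ∂μ) := by
      rw [integral_sub k0' (by exact (k0.add (k1.const_mul η)).add (k2.const_mul _)),
        integral_add (by exact k0.add (k1.const_mul η)) (k2.const_mul _),
        integral_add k0 (k1.const_mul η), integral_const_mul, integral_const_mul]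
    rw [← e]
    refine abs_integral_le_of_abs_le fun ω => ?_
    have h := abs_taylor_two_le hf hM₃0 hM₃ (a • W ω + y) (η • W ω)
    have e2 : a • W ω + y + η • W ω = a' • W ω + y := by rw [hη, sub_smul]; abel
    rw [e2] at h
    have h2 : M₃ * ‖η • W ω‖ ^ 3 ≤ M₃ * η ^ 3 * c ^ 3 := by
      rw [norm_smul, Real.norm_eq_abs, abs_of_nonneg hη0, mul_pow, ← mul_assoc]
      gcongr
      exact hWc ω
    refine le_trans (le_of_eq ?_) (h.trans h2)
    congr 1
    simp only [map_smul, _root_.smul_apply, smul_eq_mul, ← hD₁, ← hD₂]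
    ring
  have t2 : |(∫ ω, ∫ z, f (a • W ω + y + r • z) ∂γ ∂μ)
      - ((∫ ω, f (a • W ω + y) ∂μ) + r ^ 2 / 2 * ∫ ω, q (a • W ω + y) ∂μ)|
      ≤ M₃ * r ^ 3 * ∫ z, ‖z‖ ^ 3 ∂γ := by
    rw [← integral_const_mul, ← integral_add k0 (kq.const_mul _),
      ← integral_sub kG (by exact k0.add (kq.const_mul _))]
    exact abs_integral_le_of_abs_le fun ω => hG _
  have t3 : |∫ ω, D₂ (a • W ω + y) (W ω) (W ω) ∂μ| ≤ M₂ * c * c :=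
    abs_integral_le_of_abs_le fun ω => abs_apply_apply_le _ (hM₂ _) (hWc ω) (hWc ω)
  have t4 : |∫ ω, q (a • W ω + y) ∂μ| ≤ M₂ * c * c := abs_integral_le_of_abs_le fun ω => hqb _
  set I₀ := ∫ ω, f (a • W ω + y) ∂μ
  set I₁ := ∫ ω, D₁ (a • W ω + y) (W ω) ∂μ
  set I₂ := ∫ ω, D₂ (a • W ω + y) (W ω) (W ω) ∂μ
  have hA' : |I₁ - a * ∫ ω, q (a • W ω + y) ∂μ| ≤ A * a ^ 2 := hA
  set Q := ∫ ω, q (a • W ω + y) ∂μ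
  set m := ∫ z, ‖z‖ ^ 3 ∂γ
  -- The variance balance: the first-order term, turned into `η a Q` by the Stein identity, and the
  -- second-order term together give the Gaussian term `r² Q / 2`.
  have hηa : η * a + η ^ 2 / 2 = r ^ 2 / 2 := by rw [hr, hη]; ring
  clear_value η
  have e : (∫ ω, f (a' • W ω + y) ∂μ) - ∫ ω, ∫ z, f (a • W ω + y + r • z) ∂γ ∂μ
      = ((∫ ω, f (a' • W ω + y) ∂μ) - (I₀ + η * I₁ + η ^ 2 / 2 * I₂))
        - ((∫ ω, ∫ z, f (a • W ω + y + r • z) ∂γ ∂μ) - (I₀ + r ^ 2 / 2 * Q))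
        + η * (I₁ - a * Q) + η ^ 2 / 2 * (I₂ - Q) := by
    linear_combination Q * hηa
  have b1 : |η * (I₁ - a * Q)| ≤ r ^ 2 * (A / 2) := by
    rw [abs_mul, abs_of_nonneg hη0]
    calc η * |I₁ - a * Q| ≤ η * (A * a ^ 2) := by gcongr
      _ = A * a * (η * a) := by ring
      _ ≤ A * 1 * (r ^ 2 / 2) := by
        gcongr
        · exact haa'.trans ha'
        · nlinarith
      _ = _ := by ring
  have b2 : |η ^ 2 / 2 * (I₂ - Q)| ≤ r * η * (M₂ * c ^ 2) := by
    rw [abs_mul, abs_of_nonneg (by positivity)]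
    calc η ^ 2 / 2 * |I₂ - Q| ≤ η ^ 2 / 2 * (M₂ * c * c + M₂ * c * c) := by
          gcongr; exact (abs_sub _ _).trans (add_le_add t3 t4)
      _ = η * η * (M₂ * c ^ 2) := by ring
      _ ≤ _ := by gcongr
  have b3 : M₃ * η ^ 3 * c ^ 3 ≤ M₃ * r ^ 3 * c ^ 3 := by gcongr
  rw [e]
  calc _ ≤ (M₃ * r ^ 3 * c ^ 3 + M₃ * r ^ 3 * m) + r ^ 2 * (A / 2) + r * η * (M₂ * c ^ 2) :=
        (abs_add_le _ _).trans (add_le_add ((abs_add_le _ _).trans (add_le_add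
          ((abs_sub _ _).trans (add_le_add (t1.trans b3) t2)) b1)) b2)
    _ = _ := by ring

end Interpolation

/-! ### Gaussian comparison by summing interpolation steps -/

section Interpolation

variable {E : Type*} [NormedAddCommGroup E] [NormedSpace ℝ E] [FiniteDimensional ℝ E]
  [MeasurableSpace E] [BorelSpace E] {Ω : Type*} [MeasurableSpace Ω] {μ : Measure Ω}
  [IsProbabilityMeasure μ] {γ : Measure E} [IsGaussian γ]

/-- The interpolated expectation `𝔼 f(a W + s z)`, rewritten by splitting the Gaussian variable. -/
lemma integral_gaussian_split {f : E → ℝ} (hf : ContDiff ℝ 2 f) {M₂ : ℝ} (hM₂0 : 0 ≤ M₂)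
    (hM₂ : ∀ x, ‖fderiv ℝ (fderiv ℝ f) x‖ ≤ M₂)
    {W : Ω → E} (hW : Measurable W) {c : ℝ} (hWc : ∀ ω, ‖W ω‖ ≤ c) (hγ : γ[id] = 0)
    (a : ℝ) {s s' r : ℝ} (hs : 0 ≤ s) (hs' : 0 ≤ s') (h : s ^ 2 = s' ^ 2 + r ^ 2) :
    ∫ z, ∫ ω, f (a • W ω + s • z) ∂μ ∂γ
      = ∫ z, ∫ ω, ∫ z', f (a • W ω + s' • z + r • z') ∂γ ∂μ ∂γ := by
  have := FiniteDimensional.complete ℝ E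
  have mz : MemLp (id : E → E) 2 γ := IsGaussian.memLp_id γ 2 (by simp)
  have hWL : MemLp W 2 μ :=
    MemLp.of_bound hW.aestronglyMeasurable c (Filter.Eventually.of_forall hWc)
  have hH : StronglyMeasurable (fun v => ∫ ω, f (a • W ω + v) ∂μ) := by
    have : StronglyMeasurable (Function.uncurry fun (v : E) (ω : Ω) => f (a • W ω + v)) :=
      (hf.continuous.measurable.comp (by fun_prop :
        Measurable fun p : E × Ω => a • W p.2 + p.1)).stronglyMeasurable
    exact this.integral_prod_right
  have i3 : Integrable (fun p : (E × E) × Ω => f (a • W p.2 + (s' • p.1.1 + r • p.1.2)))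
      ((γ.prod γ).prod μ) := by
    refine integrable_comp_of_norm_fderiv_fderiv_le hf hM₂0 hM₂ ?_
    exact ((hWL.comp_snd (γ.prod γ)).const_smul a).add
      ((((mz.comp_fst γ).const_smul s').add ((mz.comp_snd γ).const_smul r)).comp_fst μ)
  calc ∫ z, ∫ ω, f (a • W ω + s • z) ∂μ ∂γ
      = ∫ v, ∫ ω, f (a • W ω + v) ∂μ ∂(γ.map fun z => s • z) := by
        rw [integral_map (by fun_prop) hH.aestronglyMeasurable]
    _ = ∫ q : E × E, ∫ ω, f (a • W ω + (s' • q.1 + r • q.2)) ∂μ ∂(γ.prod γ) := by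
        rw [← map_smul_add_smul_of_isGaussian hγ hs hs' h,
          integral_map (by fun_prop) hH.aestronglyMeasurable]
    _ = ∫ z, ∫ z', ∫ ω, f (a • W ω + (s' • z + r • z')) ∂μ ∂γ ∂γ :=
        integral_prod _ i3.integral_prod_left
    _ = _ := by
        refine integral_congr_ae (Filter.Eventually.of_forall fun z => ?_)
        simp only [← add_assoc]
        refine integral_integral_swap (f := fun z' ω => f (a • W ω + s' • z + r • z')) ?_
        refine integrable_comp_of_norm_fderiv_fderiv_le (ν := γ.prod μ) hf hM₂0 hM₂ ?_
        exact (((hWL.comp_snd γ).const_smul a).add (memLp_const _)).add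
          ((mz.comp_fst μ).const_smul r)

/-- Gaussian comparison by interpolation: an approximate Stein identity for `W` bounds the
distance of `𝔼 f(W)` to the Gaussian expectation. -/
theorem abs_integral_sub_integral_gaussian_le {f : E → ℝ} (hf : ContDiff ℝ 2 f) {M₂ M₃ : ℝ}
    (hM₂0 : 0 ≤ M₂) (hM₃0 : 0 ≤ M₃) (hM₂ : ∀ x, ‖fderiv ℝ (fderiv ℝ f) x‖ ≤ M₂)
    (hM₃ : ∀ x y, ‖fderiv ℝ (fderiv ℝ f) x - fderiv ℝ (fderiv ℝ f) y‖ ≤ M₃ * ‖x - y‖)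
    {W : Ω → E} (hW : Measurable W) {c : ℝ} (hWc : ∀ ω, ‖W ω‖ ≤ c) (hγ : γ[id] = 0)
    (hcov : ∀ B : E →L[ℝ] E →L[ℝ] ℝ, ∫ z, B z z ∂γ = ∫ ω, B (W ω) (W ω) ∂μ) {A : ℝ}
    (hA0 : 0 ≤ A) (hA : ∀ a y, 0 ≤ a → |(∫ ω, fderiv ℝ f (a • W ω + y) (W ω) ∂μ)
      - a * ∫ ω, ∫ ω', fderiv ℝ (fderiv ℝ f) (a • W ω + y) (W ω') (W ω') ∂μ ∂μ| ≤ A * a ^ 2) :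
    |(∫ ω, f (W ω) ∂μ) - ∫ z, f z ∂γ| ≤ A / 2 := by
  have := FiniteDimensional.complete ℝ E
  have mz : MemLp (id : E → E) 2 γ := IsGaussian.memLp_id γ 2 (by simp)
  have hWL : MemLp W 2 μ :=
    MemLp.of_bound hW.aestronglyMeasurable c (Filter.Eventually.of_forall hWc)
  have hc : 0 ≤ c := by
    obtain ⟨ω⟩ := μ.nonempty_of_neZero
    exact (norm_nonneg _).trans (hWc ω)
  set m := ∫ z, ‖z‖ ^ 3 ∂γ with hm
  have hm0 : 0 ≤ m := integral_nonneg fun z => by positivity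
  set F : ℝ → ℝ := fun t => ∫ z, ∫ ω, f (√t • W ω + √(1 - t) • z) ∂μ ∂γ with hF
  set C := M₂ * c ^ 2 + M₃ * (c ^ 3 + m) with hC
  have hC0 : 0 ≤ C := by positivity
  -- The remainder is the root of the mesh times increments of `√t` and `t`, both of which
  -- telescope; no uniform bound on the increments of `√t` near 0 is needed.
  have step : ∀ t t', 0 ≤ t → t ≤ t' → t' ≤ 1 → |F t' - F t| ≤ (t' - t) * (A / 2)
      + √(t' - t) * C * ((√t' - √t) + (t' - t)) := by
    intro t t' h0 h1 h2
    have hr : √(t' - t) ^ 2 = t' - t := Real.sq_sqrt (by linarith)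
    have hsqt : √t ^ 2 = t := Real.sq_sqrt h0
    have hsqt' : √t' ^ 2 = t' := Real.sq_sqrt (by linarith)
    have hle : √t ≤ √t' := Real.sqrt_le_sqrt h1
    have hsplit : F t = ∫ z, ∫ ω, ∫ z', f (√t • W ω + √(1 - t') • z + √(t' - t) • z') ∂γ ∂μ ∂γ :=
      integral_gaussian_split hf hM₂0 hM₂ hW hWc hγ _ (Real.sqrt_nonneg _) (Real.sqrt_nonneg _)
        (by rw [hr, Real.sq_sqrt (by linarith), Real.sq_sqrt (by linarith)]; ring)
    have i1 : Integrable (fun z => ∫ ω, f (√t' • W ω + √(1 - t') • z) ∂μ) γ := by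
      have : Integrable (fun p : E × Ω => f (√t' • W p.2 + √(1 - t') • p.1)) (γ.prod μ) :=
        integrable_comp_of_norm_fderiv_fderiv_le hf hM₂0 hM₂
          (((hWL.comp_snd γ).const_smul _).add ((mz.comp_fst μ).const_smul _))
      exact this.integral_prod_left
    have i2 : Integrable
        (fun z => ∫ ω, ∫ z', f (√t • W ω + √(1 - t') • z + √(t' - t) • z') ∂γ ∂μ) γ := by
      have : Integrable (fun p : (E × Ω) × E =>
          f (√t • W p.1.2 + √(1 - t') • p.1.1 + √(t' - t) • p.2)) ((γ.prod μ).prod γ) :=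
        integrable_comp_of_norm_fderiv_fderiv_le hf hM₂0 hM₂
          (((((hWL.comp_snd γ).const_smul _).add ((mz.comp_fst μ).const_smul _)).comp_fst γ).add
            ((mz.comp_snd (γ.prod μ)).const_smul _))
      exact this.integral_prod_left.integral_prod_left
    rw [hsplit, hF]
    simp only
    rw [← integral_sub i1 i2]
    refine abs_integral_le_of_abs_le fun z => ?_
    refine (abs_interpolation_step_le hf hM₂0 hM₃0 hM₂ hM₃ hW hWc hγ hcov (Real.sqrt_nonneg t)
      hle (by simpa using Real.sqrt_le_sqrt h2) (Real.sqrt_nonneg _)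
      (by rw [hr, hsqt, hsqt']) hA0 _ (hA _ _ (Real.sqrt_nonneg t))).trans ?_
    rw [hr, ← hm, hC]
    have p1 : 0 ≤ √(t' - t) := Real.sqrt_nonneg _
    have p2 : 0 ≤ √t' - √t := by linarith
    have p3 : 0 ≤ t' - t := by linarith
    -- `p4` and `p5` are the cross terms added when both constants are merged into `C`.
    have p4 : 0 ≤ √(t' - t) * (M₂ * c ^ 2) * (t' - t) := by positivity
    have p5 : 0 ≤ √(t' - t) * (M₃ * (c ^ 3 + m)) * (√t' - √t) := by positivity
    nlinarith
  have total : ∀ N : ℕ, 0 < N → |F 1 - F 0| ≤ A / 2 + √(1 / N) * C * 2 := by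
    intro N hN
    have hN' : (0 : ℝ) < N := by exact_mod_cast hN
    have tele : ∀ k : ℕ, k ≤ N → |F (k / N) - F 0| ≤ (k / N) * (A / 2)
        + √(1 / N) * C * (√(k / N) + k / N) := by
      intro k
      induction k with
      | zero => intro _; simp
      | succ k ih =>
        intro hk
        have h1 := ih (by omega)
        have hd : ((k + 1 : ℕ) : ℝ) / N - k / N = 1 / N := by push_cast; ring
        have h2 := step (k / N) ((k + 1 : ℕ) / N) (by positivity) (by gcongr; omega)
          (by rw [div_le_one hN']; exact_mod_cast hk)
        rw [hd] at h2
        have h3 : ((k + 1 : ℕ) : ℝ) / N = k / N + 1 / N := by linarith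
        have h4 := abs_sub_le (F ((k + 1 : ℕ) / N)) (F (k / N)) (F 0)
        have e : ((k + 1 : ℕ) : ℝ) / N * (A / 2)
            + √(1 / N) * C * (√((k + 1 : ℕ) / N) + (k + 1 : ℕ) / N)
            = (1 / N * (A / 2) + √(1 / N) * C * (√((k + 1 : ℕ) / N) - √(k / N) + 1 / N))
              + (k / N * (A / 2) + √(1 / N) * C * (√(k / N) + k / N)) := by
          linear_combination (A / 2 + √(1 / N) * C) * h3
        rw [e]
        linarith
    have h := tele N le_rfl
    rw [div_self hN'.ne'] at h
    simp only [Real.sqrt_one, one_mul] at h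
    linarith
  have hlim : Filter.Tendsto (fun N : ℕ => A / 2 + √(1 / (N : ℝ)) * C * 2) Filter.atTop
      (nhds (A / 2 + √0 * C * 2)) :=
    (((Real.continuous_sqrt.tendsto 0).comp tendsto_one_div_atTop_nhds_zero_nat).mul_const C
      |>.mul_const 2).const_add _
  have hfin : |F 1 - F 0| ≤ A / 2 := by
    have := ge_of_tendsto hlim ((Filter.eventually_gt_atTop 0).mono total)
    simpa using this
  simpa [hF] using hfin

end Interpolation

/-! ### Counting overlaps of cyclic windows -/

section Window

open scoped Fin.CommRing

variable {n : ℕ} [NeZero n]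

/-- The cyclic window of length `i` starting at `m`. -/
def window (m : Fin n) (i : ℕ) : Finset (Fin n) :=
  (Finset.range i).image fun k : ℕ => m + (k : Fin n)

lemma injOn_add_natCast (m : Fin n) {i : ℕ} (hi : i ≤ n) :
    Set.InjOn (fun k : ℕ => m + (k : Fin n)) (Finset.range i) := by
  intro k hk l hl h
  simp only [Finset.coe_range, Set.mem_Iio] at hk hl
  have h' := congrArg Fin.val (add_left_cancel h)
  simpa [Fin.val_natCast, Nat.mod_eq_of_lt (hk.trans_le hi), Nat.mod_eq_of_lt (hl.trans_le hi)]
    using h'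

lemma card_window (m : Fin n) {i : ℕ} (hi : i ≤ n) : (window m i).card = i := by
  rw [window, Finset.card_image_of_injOn (injOn_add_natCast m hi), Finset.card_range]

lemma window_mono (m : Fin n) {i j : ℕ} (h : i ≤ j) : window m i ⊆ window m j :=
  Finset.image_subset_image (by simpa using h)

lemma prod_range_eq_prod_window {x : Fin n → ℝ} (m : Fin n) {i : ℕ} (hi : i ≤ n) :
    ∏ k ∈ Finset.range i, x ⟨((m : ℕ) + k) % n, Nat.mod_lt _ m.pos⟩ = ∏ y ∈ window m i, x y := by
  rw [window, Finset.prod_image (injOn_add_natCast m hi)]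
  refine Finset.prod_congr rfl fun k _ => congrArg x ?_
  ext
  simp [Fin.val_add]

lemma mem_window_zero {i : ℕ} (x : Fin n) : x ∈ window 0 i ↔ (x : ℕ) < i := by
  simp only [window, Finset.mem_image, Finset.mem_range, zero_add]
  constructor
  · rintro ⟨k, hk, rfl⟩
    exact (Nat.mod_le k n).trans_lt hk
  · exact fun h => ⟨x, h, by simp⟩

/-- A window is described by its last point `c`: it consists of the points from which `c` is reached
in fewer than `j` steps. With this parameter the overlap with a window starting at `0` is an
ordinary interval. -/
lemma mem_window_sub {j : ℕ} (hj : 0 < j) (c x : Fin n) :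
    x ∈ window (c - ((j - 1 : ℕ) : Fin n)) j ↔ ((c - x : Fin n) : ℕ) < j := by
  simp only [window, Finset.mem_image, Finset.mem_range]
  constructor
  · rintro ⟨k, hk, rfl⟩
    have : c - (c - ((j - 1 : ℕ) : Fin n) + (k : Fin n)) = ((j - 1 - k : ℕ) : Fin n) := by
      rw [Nat.cast_sub (show k ≤ j - 1 by omega)]; ring
    rw [this]
    exact (Nat.mod_le _ n).trans_lt (by omega)
  · intro h
    refine ⟨j - 1 - (c - x : Fin n), by omega, ?_⟩
    rw [Nat.cast_sub (show ((c - x : Fin n) : ℕ) ≤ j - 1 by omega), Fin.cast_val_eq_self]; ring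

lemma window_add (m c : Fin n) (i : ℕ) :
    window (m + c) i = (window c i).map (Equiv.addLeft m).toEmbedding := by
  ext x
  simp [window, add_assoc, eq_neg_add_iff_add_eq]

lemma card_window_union (m c : Fin n) (i j : ℕ) :
    (window m i ∪ window (m + c) j).card = (window 0 i ∪ window c j).card := by
  have h : window m i = (window 0 i).map (Equiv.addLeft m).toEmbedding := by
    rw [← window_add, add_zero]
  rw [h, window_add, ← Finset.map_union, Finset.card_map]

/-- The overlap of a window starting at `0` with a window ending at `c`. -/
lemma card_window_inter {i j : ℕ} (hj : 0 < j) (hij : i + j ≤ n) (c : Fin n) :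
    (window 0 i ∩ window (c - ((j - 1 : ℕ) : Fin n)) j).card
      = min i ((c : ℕ) + 1) - ((c : ℕ) + 1 - j) := by
  -- Truncated subtraction is intended: the lower end stays at 0 while the second window still
  -- reaches back past `0`, and the length is 0 when the windows do not meet.
  rw [← Nat.card_Ico ((c : ℕ) + 1 - j) (min i ((c : ℕ) + 1)), ← Finset.card_map Fin.valEmbedding]
  refine congrArg Finset.card (Finset.ext fun k => ?_)
  simp only [Finset.mem_map, Finset.mem_inter, mem_window_zero,
    mem_window_sub hj, Fin.valEmbedding_apply, Finset.mem_Ico]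
  have hc := c.isLt
  constructor
  · rintro ⟨x, ⟨h1, h2⟩, rfl⟩
    have hx := x.isLt
    rw [Fin.val_sub] at h2
    rcases le_or_gt (x : ℕ) (c : ℕ) with hxc | hxc
    · rw [show n - (x : ℕ) + c = c - x + n by omega, Nat.add_mod_right,
        Nat.mod_eq_of_lt (by omega)] at h2
      omega
    -- The second window would have to wrap around and reach `x < i` from the other side, which `i +
    -- j ≤ n` forbids.
    · rw [Nat.mod_eq_of_lt (by omega)] at h2
      omega
  · intro h
    refine ⟨⟨k, by omega⟩, ⟨by simp; omega, ?_⟩, rfl⟩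
    rw [Fin.val_sub]
    simp only
    rw [show n - k + (c : ℕ) = c - k + n by omega, Nat.add_mod_right, Nat.mod_eq_of_lt (by omega)]
    omega

lemma card_window_union_sub {i j : ℕ} (hj : 0 < j) (hij : i + j ≤ n) (c : Fin n) :
    (window 0 i ∪ window (c - ((j - 1 : ℕ) : Fin n)) j).card
      = i + j - (min i ((c : ℕ) + 1) - ((c : ℕ) + 1 - j)) := by
  have h := Finset.card_union_add_card_inter (window 0 i)
    (window (c - ((j - 1 : ℕ) : Fin n)) j)
  rw [card_window_inter hj hij, card_window _ (show i ≤ n by omega),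
    card_window _ (show j ≤ n by omega)] at h
  omega

lemma pow_sub_sub_pow (p : ℝ) {a o : ℕ} (h : o ≤ a) :
    p ^ (a - o) - p ^ a = (1 - p) * ∑ l ∈ Finset.range o, p ^ (a - 1 - l) := by
  induction o with
  | zero => simp
  | succ o ih =>
    rw [Finset.sum_range_succ, mul_add, ← ih (by omega)]
    have h1 : a - o = a - 1 - o + 1 := by omega
    have h2 : a - (o + 1) = a - 1 - o := by omega
    rw [h1, h2, pow_succ]
    ring

/-- Each summand is a telescoping sum over levels `l` below the overlap. After exchanging sums, the
positions `c` with overlap exceeding `l` form the interval `[l, i + j - 1 - l)`. The reflection `l =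
min i j - 1 - k` turns its length into `|i - j| + 1 + 2k` and the exponent into `max i j + k`. -/
lemma sum_range_pow_overlap (p : ℝ) {i j : ℕ} (hi : 0 < i) (hj : 0 < j) (hij : i + j ≤ n) :
    ∑ c ∈ Finset.range n, (p ^ (i + j - (min i (c + 1) - (c + 1 - j))) - p ^ (i + j))
      = (1 - p) * p ^ max i j * ∑ k ∈ Finset.range (min i j),
          (|(i : ℝ) - (j : ℝ)| + 1 + 2 * (k : ℝ)) * p ^ k := by
  have h1 : ∀ c ∈ Finset.range n,
      p ^ (i + j - (min i (c + 1) - (c + 1 - j))) - p ^ (i + j)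
        = (1 - p) * ∑ l ∈ Finset.range (min i j),
            if l ≤ c ∧ c < i + j - 1 - l then p ^ (i + j - 1 - l) else 0 := fun c _ => by
    rw [pow_sub_sub_pow p (by omega), ← Finset.sum_filter]
    congr 2
    ext l
    simp only [Finset.mem_range, Finset.mem_filter]
    omega
  have h2 : ∀ l ∈ Finset.range (min i j),
      (∑ c ∈ Finset.range n, if l ≤ c ∧ c < i + j - 1 - l then p ^ (i + j - 1 - l) else 0)
        = ((i + j - 1 - 2 * l : ℕ) : ℝ) * p ^ (i + j - 1 - l) := fun l hl => by
    have : (Finset.range n).filter (fun c => l ≤ c ∧ c < i + j - 1 - l)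
        = Finset.Ico l (i + j - 1 - l) := by
      ext c
      simp only [Finset.mem_range, Finset.mem_filter, Finset.mem_Ico]
      omega
    rw [← Finset.sum_filter, this, Finset.sum_const, nsmul_eq_mul, Nat.card_Ico,
      show i + j - 1 - l - l = i + j - 1 - 2 * l by omega]
  rw [Finset.sum_congr rfl h1, ← Finset.mul_sum, Finset.sum_comm, Finset.sum_congr rfl h2,
    ← Finset.sum_range_reflect, mul_assoc]
  congr 1
  rw [Finset.mul_sum]
  refine Finset.sum_congr rfl fun k hk => ?_
  rw [Finset.mem_range] at hk
  have e1 : i + j - 1 - (min i j - 1 - k) = max i j + k := by omega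
  have e2 : ((i + j - 1 - 2 * (min i j - 1 - k) : ℕ) : ℝ) = |(i : ℝ) - (j : ℝ)| + 1 + 2 * k := by
    rcases le_total i j with h | h
    · rw [abs_sub_comm, abs_of_nonneg (by simpa using h),
        show i + j - 1 - 2 * (min i j - 1 - k) = (j - i) + 1 + 2 * k by omega]
      push_cast [h]; ring
    · rw [abs_of_nonneg (by simpa using h),
        show i + j - 1 - 2 * (min i j - 1 - k) = (i - j) + 1 + 2 * k by omega]
      push_cast [h]; ring
  rw [e1, e2, pow_add]
  ring

lemma sum_sum_pow_card_window_union (p : ℝ) {i j : ℕ} (hi : 0 < i) (hj : 0 < j)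
    (hij : i + j ≤ n) :
    ∑ m : Fin n, ∑ m' : Fin n, (p ^ (window m i ∪ window m' j).card - p ^ (i + j))
      = n * ((1 - p) * p ^ max i j * ∑ k ∈ Finset.range (min i j),
          (|(i : ℝ) - (j : ℝ)| + 1 + 2 * (k : ℝ)) * p ^ k) := by
  have h : ∀ m : Fin n,
      ∑ m' : Fin n, (p ^ (window m i ∪ window m' j).card - p ^ (i + j))
        = ∑ c ∈ Finset.range n,
            (p ^ (i + j - (min i (c + 1) - (c + 1 - j))) - p ^ (i + j)) := fun m => by
    -- Substitution `m' = m + (c - (j - 1))`, where `c` is the last point of the second window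
    -- relative to `m`.
    rw [← Fin.sum_univ_eq_sum_range
      (fun c => p ^ (i + j - (min i (c + 1) - (c + 1 - j))) - p ^ (i + j)),
      ← Equiv.sum_comp ((Equiv.subRight ((j - 1 : ℕ) : Fin n)).trans (Equiv.addLeft m))]
    refine Finset.sum_congr rfl fun c _ => ?_
    simp only [Equiv.trans_apply, Equiv.subRight_apply, Equiv.coe_addLeft, card_window_union,
      card_window_union_sub hj hij]
  simp only [h, sum_range_pow_overlap p hi hj hij, Finset.sum_const, Finset.card_univ,
    Fintype.card_fin, nsmul_eq_mul]

/-- The starting points of the windows of length `d` that meet the one starting at `m`. -/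
def neighbours (d : ℕ) (m : Fin n) : Finset (Fin n) :=
  Finset.univ.filter fun m' => ¬ Disjoint (window m d) (window m' d)

/-- A common point `m + k = m' + l` gives `m' = m + (k + d - l) - d`, and `k + d - l` is below `2 *
d`. -/
lemma card_neighbours_le (d : ℕ) (m : Fin n) : (neighbours d m).card ≤ 2 * d := by
  have h : neighbours d m
      ⊆ (Finset.range (2 * d)).image (fun t : ℕ => m + (t : Fin n) - (d : Fin n)) := by
    intro m' hm'
    simp only [neighbours, Finset.mem_filter, Finset.mem_univ, true_and, Finset.not_disjoint_iff,
      window, Finset.mem_image, Finset.mem_range] at hm'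
    obtain ⟨_, ⟨k, hk, rfl⟩, l, hl, h⟩ := hm'
    refine Finset.mem_image.2 ⟨k + (d - l), by simp; omega, ?_⟩
    rw [Nat.cast_add, Nat.cast_sub hl.le]
    linear_combination -h
  exact (Finset.card_le_card h).trans (Finset.card_image_le.trans (by simp))

end Window

/-! ### Products of Bernoulli variables -/

section Bernoulli

variable {Ω : Type*} [MeasurableSpace Ω] {μ : Measure Ω} [IsProbabilityMeasure μ]

/-- Functions of disjoint blocks of independent variables are independent. -/
lemma indepFun_of_disjoint {ι : Type*} [Fintype ι] [DecidableEq ι] {X : ι → Ω → ℝ}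
    (hX : iIndepFun X μ) (hmeas : ∀ i, Measurable (X i)) {S T : Finset ι} (hST : Disjoint S T)
    {α β : Type*} [MeasurableSpace α] [MeasurableSpace β] {F : (ι → ℝ) → α} {G : (ι → ℝ) → β}
    (hF : Measurable F) (hG : Measurable G)
    (hFS : ∀ f g : ι → ℝ, (∀ x ∈ S, f x = g x) → F f = F g)
    (hGT : ∀ f g : ι → ℝ, (∀ x ∈ T, f x = g x) → G f = G g) :
    IndepFun (fun ω => F fun i => X i ω) (fun ω => G fun i => X i ω) μ := by
  -- The default 0 outside the block is harmless, because `F` and `G` do not look there.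
  let ext : ∀ R : Finset ι, (R → ℝ) → ι → ℝ := fun R f x => if h : x ∈ R then f ⟨x, h⟩ else 0
  have hext : ∀ R, Measurable (ext R) := fun R => by
    refine measurable_pi_lambda _ fun x => ?_
    by_cases h : x ∈ R
    · simpa [ext, h] using measurable_pi_apply _
    · simp [ext, h]
  have key := (hX.indepFun_finset S T hST hmeas).comp (hF.comp (hext S)) (hG.comp (hext T))
  have e1 : (fun ω => F fun i => X i ω) = (F ∘ ext S) ∘ fun ω (i : S) => X i ω := by
    funext ω
    exact hFS _ _ fun x hx => by simp [ext, hx]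
  have e2 : (fun ω => G fun i => X i ω) = (G ∘ ext T) ∘ fun ω (i : T) => X i ω := by
    funext ω
    exact hGT _ _ fun x hx => by simp [ext, hx]
  rwa [e1, e2]

/-- Independent `{0, 1}`-valued variables with success probability `p`. -/
structure IsBernoulliFamily {ι : Type*} (X : ι → Ω → ℝ) (p : ℝ) (μ : Measure Ω) : Prop where
  measurable : ∀ k, Measurable (X k)
  zero_or_one : ∀ k ω, X k ω = 0 ∨ X k ω = 1
  integral_eq : ∀ k, ∫ ω, X k ω ∂μ = p
  indep : iIndepFun X μ

namespace IsBernoulliFamily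

variable {ι : Type*} [Fintype ι] [DecidableEq ι] {X : ι → Ω → ℝ} {p : ℝ}

lemma prod_nonneg (h : IsBernoulliFamily X p μ) (S : Finset ι) (ω : Ω) : 0 ≤ ∏ x ∈ S, X x ω :=
  Finset.prod_nonneg fun x _ => by rcases h.zero_or_one x ω with e | e <;> simp [e]

lemma prod_le_one (h : IsBernoulliFamily X p μ) (S : Finset ι) (ω : Ω) : ∏ x ∈ S, X x ω ≤ 1 :=
  Finset.prod_le_one (fun x _ => by rcases h.zero_or_one x ω with e | e <;> simp [e])
    fun x _ => by rcases h.zero_or_one x ω with e | e <;> simp [e]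

/-- Values in `{0, 1}` are idempotent, so the repeated factors on `S ∩ T` disappear. -/
lemma prod_mul_prod (h : IsBernoulliFamily X p μ) (S T : Finset ι) (ω : Ω) :
    (∏ x ∈ S, X x ω) * ∏ x ∈ T, X x ω = ∏ x ∈ S ∪ T, X x ω := by
  by_cases hz : ∃ x ∈ S ∪ T, X x ω = 0
  · obtain ⟨x, hx, h0⟩ := hz
    rw [Finset.prod_eq_zero hx h0]
    rcases Finset.mem_union.1 hx with hx | hx
    · rw [Finset.prod_eq_zero hx h0, zero_mul]
    · rw [Finset.prod_eq_zero hx h0, mul_zero]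
  · push Not at hz
    have h1 : ∀ x ∈ S ∪ T, X x ω = 1 := fun x hx => (h.zero_or_one x ω).resolve_left (hz x hx)
    rw [Finset.prod_eq_one h1, Finset.prod_eq_one fun x hx => h1 x (Finset.mem_union_left _ hx),
      Finset.prod_eq_one fun x hx => h1 x (Finset.mem_union_right _ hx), one_mul]

lemma measurable_prod (h : IsBernoulliFamily X p μ) (S : Finset ι) :
    Measurable fun ω => ∏ x ∈ S, X x ω :=
  Finset.measurable_prod S fun x _ => h.measurable x

lemma integrable_prod (h : IsBernoulliFamily X p μ) (S : Finset ι) :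
    Integrable (fun ω => ∏ x ∈ S, X x ω) μ :=
  Integrable.of_bound (h.measurable_prod S).aestronglyMeasurable 1
    (Filter.Eventually.of_forall fun ω => by
      rw [Real.norm_eq_abs, abs_of_nonneg (h.prod_nonneg S ω)]; exact h.prod_le_one S ω)

lemma integral_prod (h : IsBernoulliFamily X p μ) (S : Finset ι) :
    ∫ ω, ∏ x ∈ S, X x ω ∂μ = p ^ S.card := by
  have key := (h.indep.precomp (g := ((↑) : S → ι))
    Subtype.val_injective).integral_fun_prod_eq_prod_integral
    fun i => (h.measurable i).aestronglyMeasurable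
  have e : ∀ ω, ∏ x ∈ S, X x ω = ∏ i : S, X i ω := fun ω =>
    (Finset.prod_coe_sort S fun x => X x ω).symm
  simp only [e]
  refine key.trans ?_
  simp [h.integral_eq]

lemma integral_prod_sub_mul_prod_sub (h : IsBernoulliFamily X p μ) (S T : Finset ι) :
    ∫ ω, ((∏ x ∈ S, X x ω) - p ^ S.card) * ((∏ x ∈ T, X x ω) - p ^ T.card) ∂μ
      = p ^ (S ∪ T).card - p ^ (S.card + T.card) := by
  have e : ∀ ω, ((∏ x ∈ S, X x ω) - p ^ S.card) * ((∏ x ∈ T, X x ω) - p ^ T.card)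
      = (∏ x ∈ S ∪ T, X x ω) - p ^ T.card * (∏ x ∈ S, X x ω) - p ^ S.card * (∏ x ∈ T, X x ω)
        + p ^ (S.card + T.card) := fun ω => by
    rw [← h.prod_mul_prod, pow_add]; ring
  have i1 := h.integrable_prod (S ∪ T)
  have i2 := (h.integrable_prod S).const_mul (p ^ T.card)
  have i3 := (h.integrable_prod T).const_mul (p ^ S.card)
  simp only [e]
  rw [integral_add (by exact (i1.sub i2).sub i3) (integrable_const _),
    integral_sub (by exact i1.sub i2) i3, integral_sub i1 i2, integral_const_mul,
    integral_const_mul, h.integral_prod, h.integral_prod, h.integral_prod, pow_add]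
  simp
  ring

end IsBernoulliFamily

end Bernoulli

/-! ### Covariance of the run counts -/

section Runs

variable {Ω : Type*} [MeasurableSpace Ω] {μ : Measure Ω} [IsProbabilityMeasure μ]
  {n : ℕ} [NeZero n] {X : Fin n → Ω → ℝ} {p : ℝ}

lemma centeredRuns_eq_sum (X : Fin n → Ω → ℝ) (p : ℝ) {i : ℕ} (hi : i ≤ n) (ω : Ω) :
    centeredRuns X p i ω = ∑ m, ((∏ x ∈ window m i, X x ω) - p ^ i) :=
  Finset.sum_congr rfl fun m _ => by rw [prod_range_eq_prod_window (x := fun x => X x ω) m hi]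

lemma integral_centeredRuns_mul (h : IsBernoulliFamily X p μ) {i j : ℕ} (hi : 0 < i) (hj : 0 < j)
    (hij : i + j ≤ n) :
    ∫ ω, centeredRuns X p i ω * centeredRuns X p j ω ∂μ
      = n * ((1 - p) * p ^ max i j * ∑ k ∈ Finset.range (min i j),
          (|(i : ℝ) - (j : ℝ)| + 1 + 2 * (k : ℝ)) * p ^ k) := by
  rw [← sum_sum_pow_card_window_union p hi hj hij]
  simp only [centeredRuns_eq_sum X p (show i ≤ n by omega),
    centeredRuns_eq_sum X p (show j ≤ n by omega), Finset.sum_mul_sum]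
  have e : ∀ m m' : Fin n,
      ∫ ω, ((∏ x ∈ window m i, X x ω) - p ^ i) * ((∏ x ∈ window m' j, X x ω) - p ^ j) ∂μ
        = p ^ (window m i ∪ window m' j).card - p ^ (i + j) := fun m m' => by
    have := h.integral_prod_sub_mul_prod_sub (window m i) (window m' j)
    rwa [card_window m (show i ≤ n by omega), card_window m' (show j ≤ n by omega)] at this
  have hint : ∀ m m' : Fin n, Integrable
      (fun ω => ((∏ x ∈ window m i, X x ω) - p ^ i) * ((∏ x ∈ window m' j, X x ω) - p ^ j)) μ :=
    fun m m' => by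
      refine Integrable.bdd_mul (c := 1 + |p ^ i|)
        ((h.integrable_prod (window m' j)).sub (integrable_const _))
        ((h.measurable_prod _).sub_const _).aestronglyMeasurable
        (Filter.Eventually.of_forall fun ω => ?_)
      refine (norm_sub_le _ _).trans (add_le_add ?_ le_rfl)
      rw [Real.norm_eq_abs, abs_of_nonneg (h.prod_nonneg _ ω)]
      exact h.prod_le_one _ ω
  rw [integral_finsetSum _ fun m _ => integrable_finsetSum _ fun m' _ => hint m m']
  refine Finset.sum_congr rfl fun m _ => ?_
  rw [integral_finsetSum _ fun m' _ => hint m m']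
  exact Finset.sum_congr rfl fun m' _ => e m m'

/-- The covariance matrix of the vector of runs. -/
lemma integral_runsVector_mul (h : IsBernoulliFamily X p μ) (hp0 : 0 < p) (hp1 : p < 1) {d : ℕ}
    (hdn : 2 * d ≤ n) (i j : Fin d) :
    ∫ ω, runsVector X p d ω i * runsVector X p d ω j ∂μ = runsCov p d i j := by
  have hn : (0 : ℝ) < n := by exact_mod_cast NeZero.pos n
  have hq : 0 < 1 - p := by linarith
  have hi := i.isLt
  have hj := j.isLt
  have hV := integral_centeredRuns_mul h (Nat.succ_pos i) (Nat.succ_pos j)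
    (show (i : ℕ) + 1 + (j + 1) ≤ n by omega)
  simp only [runsVector]
  have e : ∀ ω, centeredRuns X p ((i : ℕ) + 1) ω / √(n * p ^ ((i : ℕ) + 1) * (1 - p))
      * (centeredRuns X p ((j : ℕ) + 1) ω / √(n * p ^ ((j : ℕ) + 1) * (1 - p)))
      = (√(n * p ^ ((i : ℕ) + 1) * (1 - p)) * √(n * p ^ ((j : ℕ) + 1) * (1 - p)))⁻¹
        * (centeredRuns X p ((i : ℕ) + 1) ω * centeredRuns X p ((j : ℕ) + 1) ω) := fun ω => by
    field_simp
  simp only [e, integral_const_mul, Nat.succ_eq_add_one] at hV ⊢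
  rw [hV, ← Real.sqrt_mul (by positivity)]
  -- The normalisation contains the geometric mean of the two powers of `p`; the factor `p ^ (|i -
  -- j| / 2)` lifts it to the larger exponent.
  have hs : √(n * p ^ ((i : ℕ) + 1) * (1 - p) * (n * p ^ ((j : ℕ) + 1) * (1 - p)))
      * p ^ (|(i : ℝ) - (j : ℝ)| / 2) = n * ((1 - p) * p ^ max ((i : ℕ) + 1) ((j : ℕ) + 1)) := by
    have e1 : p ^ (|(i : ℝ) - (j : ℝ)| / 2) = √(p ^ (max ((i : ℕ) + 1) ((j : ℕ) + 1)
        - min ((i : ℕ) + 1) ((j : ℕ) + 1))) := by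
      rw [Real.sqrt_eq_rpow, ← Real.rpow_natCast, ← Real.rpow_mul hp0.le]
      congr 1
      rw [Nat.cast_sub (min_le_max), Nat.cast_max, Nat.cast_min, max_sub_min_eq_abs']
      push_cast
      rw [add_sub_add_right_eq_sub]
      ring
    rw [e1, ← Real.sqrt_mul (by positivity), Real.sqrt_eq_iff_mul_self_eq (by positivity)
      (by positivity)]
    have e2 : (i : ℕ) + 1 + ((j : ℕ) + 1) + (max ((i : ℕ) + 1) ((j : ℕ) + 1)
        - min ((i : ℕ) + 1) ((j : ℕ) + 1))
        = max ((i : ℕ) + 1) ((j : ℕ) + 1) + max ((i : ℕ) + 1) ((j : ℕ) + 1) := by omega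
    have e3 : p ^ ((i : ℕ) + 1) * p ^ ((j : ℕ) + 1) * p ^ (max ((i : ℕ) + 1) ((j : ℕ) + 1)
        - min ((i : ℕ) + 1) ((j : ℕ) + 1))
        = p ^ max ((i : ℕ) + 1) ((j : ℕ) + 1) * p ^ max ((i : ℕ) + 1) ((j : ℕ) + 1) := by
      rw [← pow_add, ← pow_add, ← pow_add, e2]
    linear_combination (n : ℝ) ^ 2 * (1 - p) ^ 2 * e3
  have hpos : 0 < √(n * p ^ ((i : ℕ) + 1) * (1 - p) * (n * p ^ ((j : ℕ) + 1) * (1 - p))) := by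
    positivity
  rw [inv_mul_eq_iff_eq_mul₀ hpos.ne', runsCov, Matrix.of_apply]
  push_cast
  rw [← mul_assoc (√_), hs, add_sub_add_right_eq_sub]
  ring

lemma memLp_runsVector_apply (h : IsBernoulliFamily X p μ) {d : ℕ} (hdn : 2 * d ≤ n)
    (i : Fin d) : MemLp (fun ω => runsVector X p d ω i) 2 μ := by
  simp only [runsVector, centeredRuns_eq_sum X p (show (i : ℕ) + 1 ≤ n by omega), div_eq_mul_inv]
  have hm : ∀ m : Fin n, MemLp
      (fun ω => (∏ x ∈ window m ((i : ℕ) + 1), X x ω) - p ^ ((i : ℕ) + 1)) 2 μ := fun m => by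
    refine MemLp.sub (MemLp.of_bound (h.measurable_prod _).aestronglyMeasurable 1
      (Filter.Eventually.of_forall fun ω => ?_)) (memLp_const _)
    rw [Real.norm_eq_abs, abs_of_nonneg (h.prod_nonneg _ ω)]
    exact h.prod_le_one _ ω
  exact (memLp_finsetSum Finset.univ fun m _ => hm m).mul_const _

/-- The quadratic form at `x` is the second moment of `∑ xᵢ Wᵢ`. -/
lemma posSemidef_runsCov (h : IsBernoulliFamily X p μ) (hp0 : 0 < p) (hp1 : p < 1) {d : ℕ}
    (hdn : 2 * d ≤ n) : (runsCov p d).PosSemidef := by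
  have hint : ∀ i j : Fin d, Integrable
      (fun ω => runsVector X p d ω i * runsVector X p d ω j) μ := fun i j =>
    (memLp_runsVector_apply h hdn i).integrable_mul (memLp_runsVector_apply h hdn j)
  refine Matrix.PosSemidef.of_dotProduct_mulVec_nonneg ?_ fun x => ?_
  · ext i j
    rw [Matrix.conjTranspose_apply, star_trivial, ← integral_runsVector_mul h hp0 hp1 hdn,
      ← integral_runsVector_mul h hp0 hp1 hdn]
    simp only [mul_comm]
  · have e : star x ⬝ᵥ (runsCov p d).mulVec x
        = ∫ ω, (∑ i, x i * runsVector X p d ω i) ^ 2 ∂μ := by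
      have : ∀ ω, (∑ i, x i * runsVector X p d ω i) ^ 2 = ∑ i, ∑ j,
          x i * x j * (runsVector X p d ω i * runsVector X p d ω j) := fun ω => by
        rw [pow_two, Finset.sum_mul_sum]
        exact Finset.sum_congr rfl fun i _ => Finset.sum_congr rfl fun j _ => by ring
      simp only [this]
      rw [integral_finsetSum _ fun i _ => integrable_finsetSum _ fun j _ =>
        (hint i j).const_mul _]
      simp only [dotProduct, Matrix.mulVec, star_trivial, Finset.mul_sum]
      refine Finset.sum_congr rfl fun i _ => ?_
      rw [integral_finsetSum _ fun j _ => (hint i j).const_mul _]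
      refine Finset.sum_congr rfl fun j _ => ?_
      rw [integral_const_mul, integral_runsVector_mul h hp0 hp1 hdn]
      ring
    rw [e]
    exact integral_nonneg fun ω => sq_nonneg _

end Runs

/-! ### Local dependence and normal approximation of the run vector -/

section Runs

variable {Ω : Type*} [MeasurableSpace Ω] {μ : Measure Ω} [IsProbabilityMeasure μ]
  {n : ℕ} [NeZero n] {X : Fin n → Ω → ℝ} {p : ℝ}

/-- The contribution to the vector of runs of the windows that start at `m`. -/
def runsSummand (p : ℝ) (d : ℕ) (m : Fin n) (x : Fin n → ℝ) : EuclideanSpace ℝ (Fin d) :=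
  WithLp.toLp 2 fun i : Fin d =>
    ((∏ y ∈ window m ((i : ℕ) + 1), x y) - p ^ ((i : ℕ) + 1))
      / √(n * p ^ ((i : ℕ) + 1) * (1 - p))

lemma sum_runsSummand (X : Fin n → Ω → ℝ) (p : ℝ) {d : ℕ} (hdn : d ≤ n) (ω : Ω) :
    ∑ m, runsSummand p d m (fun x => X x ω) = runsVector X p d ω := by
  ext i
  simp only [runsSummand, runsVector, WithLp.ofLp_sum, Finset.sum_apply,
    centeredRuns_eq_sum X p (show (i : ℕ) + 1 ≤ n by omega), Finset.sum_div]

lemma measurable_runsSummand (p : ℝ) (d : ℕ) (m : Fin n) : Measurable (runsSummand p d m) := by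
  refine (WithLp.measurable_toLp 2 _).comp (measurable_pi_lambda _ fun i => ?_)
  fun_prop

lemma runsSummand_congr (p : ℝ) {d : ℕ} (m : Fin n) {x y : Fin n → ℝ}
    (h : ∀ k ∈ window m d, x k = y k) : runsSummand p d m x = runsSummand p d m y := by
  ext i
  simp only [runsSummand]
  rw [Finset.prod_congr rfl fun k hk => h k (window_mono m (Nat.succ_le_of_lt i.isLt) hk)]

/-- Each of the `d` numerators lies in `[-1, 1]`, and `p ^ d` is the smallest of the powers in the
denominators. -/
lemma norm_runsSummand_le (h : IsBernoulliFamily X p μ) (hp0 : 0 < p) (hp1 : p < 1) (d : ℕ)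
    (m : Fin n) (ω : Ω) :
    ‖runsSummand p d m (fun x => X x ω)‖ ≤ √(d / (n * p ^ d * (1 - p))) := by
  have hn : (0 : ℝ) < n := by exact_mod_cast NeZero.pos n
  have hq : 0 < 1 - p := by linarith
  rw [EuclideanSpace.norm_eq]
  refine Real.sqrt_le_sqrt ?_
  calc ∑ i, ‖runsSummand p d m (fun x => X x ω) i‖ ^ 2
      ≤ ∑ _i : Fin d, 1 / (n * p ^ d * (1 - p)) := Finset.sum_le_sum fun i _ => ?_
    _ = _ := by simp [div_eq_mul_inv]
  simp only [runsSummand]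
  rw [Real.norm_eq_abs, sq_abs, div_pow, Real.sq_sqrt (by positivity)]
  have h0 := h.prod_nonneg (window m ((i : ℕ) + 1)) ω
  have h1 := h.prod_le_one (window m ((i : ℕ) + 1)) ω
  have h2 : 0 ≤ p ^ ((i : ℕ) + 1) := by positivity
  have h3 : p ^ ((i : ℕ) + 1) ≤ 1 := pow_le_one₀ hp0.le hp1.le
  have h4 : p ^ d ≤ p ^ ((i : ℕ) + 1) := pow_le_pow_of_le_one hp0.le hp1.le i.isLt
  gcongr
  nlinarith

/-- The summands of the vector of runs are locally dependent. -/
lemma locallyDependent_runsSummand (h : IsBernoulliFamily X p μ) (hp0 : 0 < p) (hp1 : p < 1)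
    {d : ℕ} (hdn : d ≤ n) :
    LocallyDependent μ (fun m ω => runsSummand p d m fun x => X x ω) (neighbours d)
      (√(d / (n * p ^ d * (1 - p)))) (2 * d) := by
  have hmeasX : Measurable fun ω => fun x => X x ω := measurable_pi_lambda _ h.measurable
  have hmeas : ∀ m, Measurable fun ω => runsSummand p d m fun x => X x ω := fun m =>
    (measurable_runsSummand p d m).comp hmeasX
  have hint : ∀ m, Integrable (fun ω => runsSummand p d m fun x => X x ω) μ := fun m =>
    integrable_comp_of_bounded continuous_id (hmeas m) (norm_runsSummand_le h hp0 hp1 d m)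
  have hsum : ∀ R : Finset (Fin n), Measurable fun x => ∑ j ∈ R, runsSummand p d j x := fun R =>
    Finset.measurable_sum R fun j _ => measurable_runsSummand p d j
  -- Summands whose windows avoid `S` depend only on the trials outside `S`; this provides the
  -- second block in both independence claims.
  have hcompl : ∀ (R S : Finset (Fin n)), (∀ j ∈ R, Disjoint S (window j d)) →
      ∀ f g : Fin n → ℝ, (∀ x ∈ Sᶜ, f x = g x) →
        ∑ j ∈ R, runsSummand p d j f = ∑ j ∈ R, runsSummand p d j g := fun R S hRS f g hfg =>
    Finset.sum_congr rfl fun j hj => runsSummand_congr p j fun x hx =>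
      hfg x (Finset.mem_compl.2 fun hxS => Finset.disjoint_left.1 (hRS j hj) hxS hx)
  refine ⟨hmeas, norm_runsSummand_le h hp0 hp1 d, fun m => ?_, fun m => ?_, fun m => ?_,
    fun m m' _ => ?_⟩
  · ext i
    have := (EuclideanSpace.proj (𝕜 := ℝ) i).integral_comp_comm (hint m)
    simp only [PiLp.proj_apply] at this
    rw [← this]
    simp only [runsSummand, integral_div]
    rw [integral_sub (h.integrable_prod _) (integrable_const _), h.integral_prod,
      card_window m (show (i : ℕ) + 1 ≤ n by omega)]
    simp
  · exact_mod_cast card_neighbours_le d m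
  · refine indepFun_of_disjoint h.indep h.measurable (S := window m d) (T := (window m d)ᶜ)
      disjoint_compl_right (measurable_runsSummand p d m) (hsum _)
      (fun f g => runsSummand_congr p m) (hcompl _ _ fun j hj => ?_)
    simpa [neighbours] using hj
  · refine indepFun_of_disjoint h.indep h.measurable (S := window m d ∪ window m' d)
      (T := (window m d ∪ window m' d)ᶜ) (F := fun x => (runsSummand p d m' x, runsSummand p d m x))
      disjoint_compl_right
      ((measurable_runsSummand p d m').prodMk (measurable_runsSummand p d m)) (hsum _)
      (fun f g hfg => Prod.ext
        (runsSummand_congr p m' fun x hx => hfg x (Finset.mem_union_right _ hx))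
        (runsSummand_congr p m fun x hx => hfg x (Finset.mem_union_left _ hx)))
      (hcompl _ _ fun j hj => ?_)
    rw [Finset.disjoint_union_left]
    simpa [neighbours] using hj

lemma apply_apply_eq_sum {d : ℕ}
    (B : EuclideanSpace ℝ (Fin d) →L[ℝ] EuclideanSpace ℝ (Fin d) →L[ℝ] ℝ)
    (z : EuclideanSpace ℝ (Fin d)) :
    B z z = ∑ i, ∑ j, z i * z j
      * B (EuclideanSpace.basisFun (Fin d) ℝ i) (EuclideanSpace.basisFun (Fin d) ℝ j) := by
  conv_lhs => rw [← (EuclideanSpace.basisFun (Fin d) ℝ).sum_repr z]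
  simp only [map_sum, map_smul, _root_.sum_apply, _root_.smul_apply, smul_eq_mul,
    EuclideanSpace.basisFun_repr, Finset.mul_sum]
  rw [Finset.sum_comm]
  refine Finset.sum_congr rfl fun i _ => Finset.sum_congr rfl fun j _ => by ring

lemma integral_bilin_eq_sum {d : ℕ} {T : Type*} [MeasurableSpace T] {ν : Measure T}
    {U : T → EuclideanSpace ℝ (Fin d)} (hU : ∀ i, MemLp (fun t => U t i) 2 ν)
    (B : EuclideanSpace ℝ (Fin d) →L[ℝ] EuclideanSpace ℝ (Fin d) →L[ℝ] ℝ) :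
    ∫ t, B (U t) (U t) ∂ν = ∑ i, ∑ j, (∫ t, U t i * U t j ∂ν)
      * B (EuclideanSpace.basisFun (Fin d) ℝ i) (EuclideanSpace.basisFun (Fin d) ℝ j) := by
  have hi : ∀ i j, Integrable (fun t => U t i * U t j
      * B (EuclideanSpace.basisFun (Fin d) ℝ i) (EuclideanSpace.basisFun (Fin d) ℝ j)) ν :=
    fun i j => ((hU i).integrable_mul (hU j)).mul_const _
  simp only [fun t => apply_apply_eq_sum B (U t)]
  rw [integral_finsetSum _ fun i _ => integrable_finsetSum _ fun j _ => hi i j]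
  refine Finset.sum_congr rfl fun i _ => ?_
  rw [integral_finsetSum _ fun j _ => hi i j]
  exact Finset.sum_congr rfl fun j _ => integral_mul_const _ _

lemma memLp_multivariateGaussian_apply {d : ℕ} (S : Matrix (Fin d) (Fin d) ℝ) (i : Fin d) :
    MemLp (fun z : EuclideanSpace ℝ (Fin d) => z i) 2 (multivariateGaussian 0 S) :=
  IsGaussian.memLp_dual (multivariateGaussian 0 S) (EuclideanSpace.proj i) 2 (by simp)

lemma integral_multivariateGaussian_mul {d : ℕ} {S : Matrix (Fin d) (Fin d) ℝ}
    (hS : S.PosSemidef) (i j : Fin d) :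
    ∫ z : EuclideanSpace ℝ (Fin d), z i * z j ∂(multivariateGaussian 0 S) = S i j := by
  have hmean : ∀ i, ∫ z : EuclideanSpace ℝ (Fin d), z i ∂(multivariateGaussian 0 S) = 0 :=
    fun i => by
      have := (EuclideanSpace.proj (𝕜 := ℝ) i).integral_comp_comm
        (IsGaussian.integrable_id (μ := multivariateGaussian (0 : EuclideanSpace ℝ (Fin d)) S))
      simpa using this
  rw [← covariance_eval_multivariateGaussian (μ := 0) hS i j,
    covariance_eq_sub (memLp_multivariateGaussian_apply S i) (memLp_multivariateGaussian_apply S j),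
    hmean, zero_mul, sub_zero]
  rfl

/-- Normal approximation of the vector of runs, for smooth test functions. -/
theorem abs_integral_runsVector_sub_le (h : IsBernoulliFamily X p μ) (hp0 : 0 < p) (hp1 : p < 1)
    {d : ℕ} (hdn : 2 * d ≤ n) {f : EuclideanSpace ℝ (Fin d) → ℝ} (hf : ContDiff ℝ 2 f) {M₂ M₃ : ℝ}
    (hM₂0 : 0 ≤ M₂) (hM₃0 : 0 ≤ M₃) (hM₂ : ∀ x, ‖fderiv ℝ (fderiv ℝ f) x‖ ≤ M₂)
    (hM₃ : ∀ x y, ‖fderiv ℝ (fderiv ℝ f) x - fderiv ℝ (fderiv ℝ f) y‖ ≤ M₃ * ‖x - y‖) :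
    |(∫ ω, f (runsVector X p d ω) ∂μ) - ∫ z, f z ∂(multivariateGaussian 0 (runsCov p d))|
      ≤ 10 * n * d ^ 2 * √(d / (n * p ^ d * (1 - p))) ^ 3 * M₃ := by
  have hld := locallyDependent_runsSummand h hp0 hp1 (show d ≤ n by omega)
  have hS := posSemidef_runsCov h hp0 hp1 hdn
  have hcd : ContDiff ℝ 1 (fderiv ℝ f) := hf.fderiv_right (by norm_num)
  have hW : Measurable (runsVector X p d) := by
    have := hld.measurable_sum Finset.univ
    simpa only [sum_runsSummand X p (show d ≤ n by omega)] using this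
  have hWc := hld.norm_sum_le Finset.univ
  simp only [sum_runsSummand X p (show d ≤ n by omega)] at hWc
  have key := abs_integral_sub_integral_gaussian_le (γ := multivariateGaussian 0 (runsCov p d))
    hf hM₂0 hM₃0 hM₂ hM₃ hW hWc integral_id_multivariateGaussian'
    (fun B => by
      rw [integral_bilin_eq_sum (memLp_multivariateGaussian_apply _),
        integral_bilin_eq_sum (memLp_runsVector_apply h hdn)]
      simp only [integral_multivariateGaussian_mul hS, integral_runsVector_mul h hp0 hp1 hdn])
    -- The Stein error with `K = 2 * d`; the comparison halves it, which yields the factor 10.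
    (A := 5 * Fintype.card (Fin n) * (2 * d) ^ 2 * √(d / (n * p ^ d * (1 - p))) ^ 3 * M₃)
    (by positivity) (fun a y ha => by
      have := hld.abs_integral_sub_le hcd.continuous (hcd.continuous_fderiv (by norm_num)) hM₃0
        (norm_taylor_one_le (hcd.differentiable (by norm_num)) hM₃0 hM₃) hM₃ (Real.sqrt_nonneg _)
        ha y
      simpa only [sum_runsSummand X p (show d ≤ n by omega)] using this)
  refine key.trans (le_of_eq ?_)
  rw [Fintype.card_fin]
  ring

/-- Written in the square roots of `d`, `n`, `p ^ d` and `1 - p`, the two sides differ only in their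
constants, and `10 ≤ 40 / 3`. -/
lemma runs_rate_le (hp0 : 0 < p) (hp1 : p < 1) (d : ℕ) :
    10 * n * d ^ 2 * √(d / (n * p ^ d * (1 - p))) ^ 3
      ≤ 40 * (d : ℝ) ^ (7 / 2 : ℝ)
        / (3 * p ^ (3 * (d : ℝ) / 2) * (1 - p) ^ (3 / 2 : ℝ) * √n) := by
  have hn : (0 : ℝ) < n := by exact_mod_cast NeZero.pos n
  have hq : 0 < 1 - p := by linarith
  have e : ∀ {x : ℝ} (k : ℕ), 0 ≤ x → x ^ ((k : ℝ) / 2) = √x ^ k := fun {x} k hx => by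
    rw [Real.sqrt_eq_rpow, ← Real.rpow_natCast, ← Real.rpow_mul hx]
    congr 1
    ring
  have e1 : (d : ℝ) ^ (7 / 2 : ℝ) = √d ^ 7 := by exact_mod_cast e 7 (Nat.cast_nonneg d)
  have e2 : p ^ (3 * (d : ℝ) / 2) = √(p ^ d) ^ 3 := by
    rw [← e 3 (by positivity), ← Real.rpow_natCast, ← Real.rpow_mul hp0.le]
    congr 1
    push_cast
    ring
  have e3 : (1 - p) ^ (3 / 2 : ℝ) = √(1 - p) ^ 3 := by exact_mod_cast e 3 hq.le
  rw [e1, e2, e3, Real.sqrt_div (Nat.cast_nonneg d), Real.sqrt_mul (by positivity),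
    Real.sqrt_mul (by positivity)]
  have hu : √(d : ℝ) ^ 2 = d := Real.sq_sqrt (Nat.cast_nonneg d)
  have hv : √(n : ℝ) ^ 2 = n := Real.sq_sqrt hn.le
  have hv0 : 0 < √(n : ℝ) := Real.sqrt_pos.2 hn
  have hw0 : 0 < √(p ^ d) := Real.sqrt_pos.2 (by positivity)
  have hz0 : 0 < √(1 - p) := Real.sqrt_pos.2 hq
  have hu0 : 0 ≤ √(d : ℝ) := Real.sqrt_nonneg _
  generalize √(n : ℝ) = v at *
  generalize √(p ^ d) = w at *
  generalize √(1 - p) = z at *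
  generalize √(d : ℝ) = u at *
  rw [← hu, ← hv, div_pow, ← mul_div_assoc, div_le_div_iff₀ (by positivity) (by positivity)]
  have : 0 ≤ u ^ 7 * (v * w * z) ^ 3 := by positivity
  nlinarith

end Runs

/-! ### Passage to surely `{0, 1}`-valued trials, and norms of derivatives -/

section Reduction

variable {Ω : Type*} [MeasurableSpace Ω] {μ : Measure Ω} [IsProbabilityMeasure μ]

/-- Independent variables that are almost surely `{0, 1}`-valued agree almost surely with
a Bernoulli family. -/
lemma exists_isBernoulliFamily {ι : Type*} [Finite ι] {p : ℝ} (hp0 : 0 < p) (hp1 : p < 1)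
    {X : ι → Ω → ℝ} (hXmeas : ∀ k, Measurable (X k))
    (hXone : ∀ k, μ {ω | X k ω = 1} = ENNReal.ofReal p)
    (hXzero : ∀ k, μ {ω | X k ω = 0} = ENNReal.ofReal (1 - p)) (hX : iIndepFun X μ) :
    ∃ Y : ι → Ω → ℝ, IsBernoulliFamily Y p μ ∧ ∀ᵐ ω ∂μ, ∀ k, X k ω = Y k ω := by
  classical
  have hg : Measurable (Set.indicator ({1} : Set ℝ) fun _ => (1 : ℝ)) :=
    measurable_const.indicator (measurableSet_singleton 1)
  -- Exceptional values of `X k` are sent to 0. Applying a fixed function to each variable preserves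
  -- independence.
  refine ⟨fun k ω => Set.indicator ({1} : Set ℝ) (fun _ => (1 : ℝ)) (X k ω),
    ⟨fun k => hg.comp (hXmeas k), fun k ω => ?_, fun k => ?_, hX.comp _ fun _ => hg⟩, ?_⟩
  · by_cases h : X k ω = 1 <;> simp [h]
  · have hm : MeasurableSet {ω | X k ω = 1} := hXmeas k (measurableSet_singleton 1)
    have e : (fun ω => Set.indicator ({1} : Set ℝ) (fun _ => (1 : ℝ)) (X k ω))
        = Set.indicator {ω | X k ω = 1} fun _ => (1 : ℝ) := by
      ext ω
      simp [Set.indicator]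
    rw [e, integral_indicator_const _ hm, Measure.real, hXone, ENNReal.toReal_ofReal hp0.le,
      smul_eq_mul, mul_one]
  · rw [ae_all_iff]
    intro k
    have hm1 : MeasurableSet {ω | X k ω = 1} := hXmeas k (measurableSet_singleton 1)
    have hm0 : MeasurableSet {ω | X k ω = 0} := hXmeas k (measurableSet_singleton 0)
    have hd : Disjoint {ω | X k ω = 1} {ω | X k ω = 0} :=
      Set.disjoint_left.2 fun ω h1 h0 => by
        simp only [Set.mem_ofPred_eq] at h1 h0
        rw [h1] at h0
        exact one_ne_zero h0
    have hfull : μ ({ω | X k ω = 1} ∪ {ω | X k ω = 0}) = 1 := by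
      rw [measure_union hd hm0, hXone, hXzero, ← ENNReal.ofReal_add hp0.le (by linarith)]
      simp
    have hae : ∀ᵐ ω ∂μ, ω ∈ {ω | X k ω = 1} ∪ {ω | X k ω = 0} :=
      (prob_compl_eq_zero_iff (hm1.union hm0)).2 hfull
    filter_upwards [hae] with ω hω
    rcases hω with h | h <;> simp only [Set.mem_ofPred_eq] at h <;> simp [h]

lemma norm_fderiv_fderiv_eq {E : Type*} [NormedAddCommGroup E] [NormedSpace ℝ E] (f : E → ℝ)
    (x : E) : ‖fderiv ℝ (fderiv ℝ f) x‖ = ‖iteratedFDeriv ℝ 2 f x‖ := by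
  rw [← norm_iteratedFDeriv_fderiv (n := 1), ← norm_iteratedFDeriv_fderiv (n := 0),
    norm_iteratedFDeriv_zero]

lemma norm_fderiv_fderiv_fderiv_eq {E : Type*} [NormedAddCommGroup E] [NormedSpace ℝ E]
    (f : E → ℝ) (x : E) :
    ‖fderiv ℝ (fderiv ℝ (fderiv ℝ f)) x‖ = ‖iteratedFDeriv ℝ 3 f x‖ := by
  rw [← norm_iteratedFDeriv_fderiv (n := 2), ← norm_iteratedFDeriv_fderiv (n := 1),
    ← norm_iteratedFDeriv_fderiv (n := 0), norm_iteratedFDeriv_zero]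

lemma norm_iteratedFDeriv_le_toReal_supNormDeriv {d k : ℕ} {f : EuclideanSpace ℝ (Fin d) → ℝ}
    (h : supNormDeriv k f < ∞) (x : EuclideanSpace ℝ (Fin d)) :
    ‖iteratedFDeriv ℝ k f x‖ ≤ (supNormDeriv k f).toReal := by
  have := ENNReal.toReal_mono h.ne (le_iSup (fun x => ‖iteratedFDeriv ℝ k f x‖ₑ) x)
  simpa using this

end Reduction

end RunsOnLine

end

/-! ### Assembly of the theorem -/

set_option maxSynthPendingDepth 3 in
open RunsOnLine in
theorem mainTheorem5 {Ω Ω' : Type*} [MeasurableSpace Ω] [MeasurableSpace Ω']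
    (μ : Measure Ω) [IsProbabilityMeasure μ] (μ' : Measure Ω') [IsProbabilityMeasure μ']
    (n d : ℕ) (hd : 1 ≤ d) (hdn : (d : ℝ) < n / 2)
    (p : ℝ) (hp0 : 0 < p) (hp1 : p < 1)
    (X : Fin n → Ω → ℝ) (hXmeas : ∀ k, Measurable (X k))
    (hXone : ∀ k, μ {ω | X k ω = 1} = ENNReal.ofReal p)
    (hXzero : ∀ k, μ {ω | X k ω = 0} = ENNReal.ofReal (1 - p))
    (hXindep : iIndepFun X μ)
    (Z : Ω' → EuclideanSpace ℝ (Fin d))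
    (hZ : HasLaw Z (stdGaussian (EuclideanSpace ℝ (Fin d))) μ') :
    (∀ i j : Fin d,
      ∫ ω, RunsOnLine.runsVector X p d ω i * RunsOnLine.runsVector X p d ω j ∂μ
        = RunsOnLine.runsCov p d i j) ∧
    (RunsOnLine.runsCov p d).PosSemidef ∧
    ∀ h : EuclideanSpace ℝ (Fin d) → ℝ, ContDiff ℝ 3 h →
      Integrable (fun ω => h (RunsOnLine.runsVector X p d ω)) μ ∧
      (RunsOnLine.supNormDeriv 2 h < ∞ → RunsOnLine.supNormDeriv 3 h < ∞ →
        Integrable (fun ω' => h (RunsOnLine.applySqrt (RunsOnLine.runsCov p d) (Z ω'))) μ') ∧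
      ENNReal.ofReal
          |(∫ ω, h (RunsOnLine.runsVector X p d ω) ∂μ)
            - ∫ ω', h (RunsOnLine.applySqrt (RunsOnLine.runsCov p d) (Z ω')) ∂μ'|
        ≤ ENNReal.ofReal (15 * Real.sqrt 6 * (d : ℝ) ^ 3 / (p ^ d * (1 - p) * Real.sqrt n))
              * RunsOnLine.supNormDeriv 2 h
          + ENNReal.ofReal (40 * (d : ℝ) ^ (7 / 2 : ℝ)
              / (3 * p ^ (3 * (d : ℝ) / 2) * (1 - p) ^ (3 / 2 : ℝ) * Real.sqrt n))
              * RunsOnLine.supNormDeriv 3 h := by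
  have hn0 : (0 : ℝ) < n := by
    have : (1 : ℝ) ≤ d := by exact_mod_cast hd
    linarith
  have : NeZero n := ⟨by rintro rfl; simp at hn0⟩
  have hdn' : 2 * d ≤ n := by
    have : (2 : ℝ) * d ≤ n := by linarith
    exact_mod_cast this
  obtain ⟨Y, hY, hXY⟩ := exists_isBernoulliFamily hp0 hp1 hXmeas hXone hXzero hXindep
  have hWae : ∀ᵐ ω ∂μ, runsVector X p d ω = runsVector Y p d ω := by
    filter_upwards [hXY] with ω hω
    simp only [runsVector, centeredRuns, hω]
  have hld := locallyDependent_runsSummand hY hp0 hp1 (show d ≤ n by omega)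
  have hWm : Measurable (runsVector Y p d) := by
    have := hld.measurable_sum Finset.univ
    simpa only [sum_runsSummand Y p (show d ≤ n by omega)] using this
  have hWc := hld.norm_sum_le Finset.univ
  simp only [sum_runsSummand Y p (show d ≤ n by omega)] at hWc
  have hlaw : μ'.map (fun ω' => applySqrt (runsCov p d) (Z ω'))
      = multivariateGaussian 0 (runsCov p d) := by
    have e : (fun ω' => applySqrt (runsCov p d) (Z ω'))
        = (fun z => (0 : EuclideanSpace ℝ (Fin d)) + applySqrt (runsCov p d) z) ∘ Z := by
      ext1 ω'
      simp
    have hm : Measurable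
        (fun z => (0 : EuclideanSpace ℝ (Fin d)) + applySqrt (runsCov p d) z) := by
      unfold applySqrt
      fun_prop
    rw [e, ← AEMeasurable.map_map_of_aemeasurable hm.aemeasurable hZ.aemeasurable, hZ.map_eq]
    -- `multivariateGaussian 0 S` is by definition the image of `stdGaussian` under `z ↦ 0 + S^(1/2)
    -- z`.
    rfl
  have hGm : AEMeasurable (fun ω' => applySqrt (runsCov p d) (Z ω')) μ' := by
    have := hZ.aemeasurable
    unfold applySqrt
    fun_prop
  refine ⟨fun i j => ?_, posSemidef_runsCov hY hp0 hp1 hdn', fun h hh => ⟨?_, fun h2 _ => ?_, ?_⟩⟩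
  · rw [← integral_runsVector_mul hY hp0 hp1 hdn']
    refine integral_congr_ae ?_
    filter_upwards [hWae] with ω hω
    rw [hω]
  · refine (integrable_comp_of_bounded hh.continuous hWm hWc).congr ?_
    filter_upwards [hWae] with ω hω
    rw [hω]
  · have hi : Integrable h (multivariateGaussian 0 (runsCov p d)) :=
      integrable_comp_of_norm_fderiv_fderiv_le (hh.of_le (by norm_num)) ENNReal.toReal_nonneg
        (fun x => (norm_fderiv_fderiv_eq h x).trans_le
          (norm_iteratedFDeriv_le_toReal_supNormDeriv h2 x)) IsGaussian.memLp_two_id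
    rw [← hlaw] at hi
    exact hi.comp_aemeasurable hGm
  · have hd0 : (0 : ℝ) < d := by exact_mod_cast hd
    have hq : 0 < 1 - p := by linarith
    -- Strict positivity is needed because `0 * ∞ = 0` in `ℝ≥0∞`: it makes the right-hand side
    -- infinite as soon as one supremum is.
    have hc2 : 0 < 15 * Real.sqrt 6 * (d : ℝ) ^ 3 / (p ^ d * (1 - p) * Real.sqrt n) := by
      positivity
    have hc3 : 0 < 40 * (d : ℝ) ^ (7 / 2 : ℝ)
        / (3 * p ^ (3 * (d : ℝ) / 2) * (1 - p) ^ (3 / 2 : ℝ) * Real.sqrt n) := by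
      positivity
    rcases (le_top : supNormDeriv 2 h ≤ ∞).eq_or_lt with h2 | h2
    · rw [h2, ENNReal.mul_top (ENNReal.ofReal_pos.2 hc2).ne', top_add]
      exact le_top
    rcases (le_top : supNormDeriv 3 h ≤ ∞).eq_or_lt with h3 | h3
    · rw [h3, ENNReal.mul_top (ENNReal.ofReal_pos.2 hc3).ne', add_top]
      exact le_top
    -- The `M₂` term is discarded; the `M₃` term alone dominates.
    refine le_add_left ?_
    have hh2 : ContDiff ℝ 2 h := hh.of_le (by norm_num)
    have hdiff : Differentiable ℝ (fderiv ℝ (fderiv ℝ h)) :=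
      ((hh.fderiv_right (m := 2) (by norm_num)).fderiv_right (m := 1) (by norm_num)).differentiable
        (by norm_num)
    have key := abs_integral_runsVector_sub_le hY hp0 hp1 hdn' hh2 ENNReal.toReal_nonneg
      ENNReal.toReal_nonneg (fun x => (norm_fderiv_fderiv_eq h x).trans_le
          (norm_iteratedFDeriv_le_toReal_supNormDeriv h2 x))
      (fun x y => norm_sub_le_mul_norm_of_norm_fderiv_le hdiff
        (fun z => (norm_fderiv_fderiv_fderiv_eq h z).trans_le
          (norm_iteratedFDeriv_le_toReal_supNormDeriv h3 z)) y x)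
    have e1 : ∫ ω, h (runsVector X p d ω) ∂μ = ∫ ω, h (runsVector Y p d ω) ∂μ := by
      refine integral_congr_ae ?_
      filter_upwards [hWae] with ω hω
      rw [hω]
    have e2 : ∫ ω', h (applySqrt (runsCov p d) (Z ω')) ∂μ'
        = ∫ z, h z ∂(multivariateGaussian 0 (runsCov p d)) := by
      rw [← hlaw, integral_map hGm hh.continuous.aestronglyMeasurable]
    rw [e1, e2]
    calc _ ≤ _ := ENNReal.ofReal_le_ofReal
          (key.trans (mul_le_mul_of_nonneg_right (runs_rate_le hp0 hp1 d) ENNReal.toReal_nonneg))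
      _ = _ := by rw [ENNReal.ofReal_mul hc3.le, ENNReal.ofReal_toReal h3.ne]
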